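/- Let $M$ be a compact connected complex manifold of complex dimension $n$ with a Kähler form $\omega$ (a smooth closed positive real $(1,1)$-form). Suppose $(M,\omega)$ is quantizable, and let $(L,h,\nabla)$ be a quantum line bundle for it: $L$ is a holomorphic line bundle on $M$, $h$ is a smooth Hermitian metric on $L$ (antilinear in the first argument), and $\nabla$ is a connection on $L$ compatible with $h$ and with the complex structure, such that $\nabla_X\nabla_Y-\nabla_Y\nabla_X-\nabla_{[X,Y]}=-\mathrm{i}\,\omega(X,Y)$ for all vector fields $X,Y$. For $m\in\mathbb{N}_0$ let $h^{(m)}$ be the Hermitian metric induced by $h$ on $L^m=L^{\otimes m}$, let $$\langle\varphi,\psi\rangle=\int_M h^{(m)}(\varphi,\psi)\,\Omega,\qquad \Omega=\tfrac1{n!}\,\omega^{\wedge n},$$ be the scalar product of $C^\infty$-sections of $L^m$, and let $\Gamma_{hol}(M,L^m)$ be the space of global holomorphic sections of $L^m$. Then for every $m\in\mathbb{N}_0$ every $C^\infty$-section $\psi$ of $L^m$ has a unique orthogonal projection $\Pi^{(m)}\psi\in\Gamma_{hol}(M,L^m)$, the Toeplitz operators $$T_f^{(m)}:\Gamma_{hol}(M,L^m)\to\Gamma_{hol}(M,L^m),\qquad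 T_f^{(m)}(s)=\Pi^{(m)}(f\cdot s),\qquad f\in C^\infty(M)=C^\infty(M,\mathbb{C}),$$ are linear and depend linearly on $f$, and the Toeplitz map $$C^\infty(M)\to\mathrm{End}\big(\Gamma_{hol}(M,L^m)\big),\qquad f\mapsto T_f^{(m)},$$ is surjective. -/

import Mathlib

open Bundle MeasureTheory
open scoped Manifold ContDiff TensorProduct ComplexConjugate

noncomputable section

/-! Shortcuts that make instance search find the usual normed space structures directly. -/

instance normedSpaceRealComplex :
    @NormedSpace ℝ ℂ _ Complex.instNormedAddCommGroup.toSeminormedAddCommGroup :=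
  NormedAlgebra.toNormedSpace ℂ

instance normedSpaceComplexSelf :
    @NormedSpace ℂ ℂ _ Complex.instNormedAddCommGroup.toSeminormedAddCommGroup :=
  NormedField.toNormedSpace

instance normedSpaceComplexPi (n : ℕ) :
    @NormedSpace ℂ (Fin n → ℂ) _ Pi.normedAddCommGroup.toSeminormedAddCommGroup :=
  Pi.normedSpace

instance normedSpaceRealPi (n : ℕ) :
    @NormedSpace ℝ (Fin n → ℂ) _ Pi.normedAddCommGroup.toSeminormedAddCommGroup :=
  Pi.normedSpace

/-! ### Complex manifolds, and their underlying real manifolds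

A complex manifold of dimension `n` is a space `M` charted on `ℂⁿ` with holomorphic (that is, complex
analytic) changes of charts: `IsManifold 𝓘(ℂ, Fin n → ℂ) ω M`.  The same charts make `M` a smooth real
manifold with model `𝓘(ℝ, Fin n → ℂ)`; "smooth" refers to this structure. -/

instance realManifoldOfComplex {n : ℕ} {M : Type*} [TopologicalSpace M]
    [ChartedSpace (Fin n → ℂ) M] [hM : IsManifold 𝓘(ℂ, Fin n → ℂ) ω M] :
    IsManifold 𝓘(ℝ, Fin n → ℂ) ω M := by
  apply isManifold_of_contDiffOn
  intro e e' he he'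
  have h2 := (contDiffGroupoid ω 𝓘(ℂ, Fin n → ℂ)).compatible he he'
  rw [contDiffGroupoid, mem_groupoid_of_pregroupoid] at h2
  exact h2.1.restrict_scalars ℝ

/-- The algebra `C^∞(M)` of complex valued smooth functions on `M`. -/
def smoothFunctions (n : ℕ) (M : Type*) [TopologicalSpace M] [ChartedSpace (Fin n → ℂ) M] :
    Subalgebra ℂ (M → ℂ) where
  carrier := {f | ContMDiff 𝓘(ℝ, Fin n → ℂ) 𝓘(ℝ, ℂ) ∞ f}
  mul_mem' hf hg := (contDiff_mul (𝕜 := ℝ) (𝔸 := ℂ)).contMDiff.comp (hf.prodMk_space hg)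
  add_mem' hf hg := ContMDiff.add hf hg
  algebraMap_mem' _ := contMDiff_const

section Forms

variable {n : ℕ} {M : Type*} [TopologicalSpace M] [ChartedSpace (Fin n → ℂ) M]

/-- The complex structure `J` on the real tangent spaces: multiplication by `i` in `ℂⁿ`. -/
def almostComplex (x : M) (v : TangentSpace 𝓘(ℝ, Fin n → ℂ) x) :
    TangentSpace 𝓘(ℝ, Fin n → ℂ) x :=
  let w : Fin n → ℂ := v
  Complex.I • w

/-- The expression of a real 2-form in a chart `φ`, that is, its pullback by `φ⁻¹`. -/
def formInChart (Ω : Π x : M, TangentSpace 𝓘(ℝ, Fin n → ℂ) x [⋀^Fin 2]→L[ℝ] ℝ)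
    (φ : OpenPartialHomeomorph M (Fin n → ℂ)) (y : Fin n → ℂ) : (Fin n → ℂ) [⋀^Fin 2]→L[ℝ] ℝ :=
  (Ω (φ.symm y)).compContinuousLinearMap
    (mfderiv 𝓘(ℝ, Fin n → ℂ) 𝓘(ℝ, Fin n → ℂ) φ.symm y)

/-- `Ω` is a Kähler form: a smooth closed positive real `(1,1)`-form. -/
structure IsKahlerForm (Ω : Π x : M, TangentSpace 𝓘(ℝ, Fin n → ℂ) x [⋀^Fin 2]→L[ℝ] ℝ) : Prop where
  smooth : ∀ φ ∈ atlas (Fin n → ℂ) M, ContDiffOn ℝ ∞ (formInChart Ω φ) φ.target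
  closed : ∀ φ ∈ atlas (Fin n → ℂ) M, ∀ y ∈ φ.target, extDeriv (formInChart Ω φ) y = 0
  type_one_one : ∀ (x : M) (v w : TangentSpace 𝓘(ℝ, Fin n → ℂ) x),
    Ω x ![almostComplex x v, almostComplex x w] = Ω x ![v, w]
  positive : ∀ (x : M) (v : TangentSpace 𝓘(ℝ, Fin n → ℂ) x), v ≠ 0 →
    0 < Ω x ![v, almostComplex x v]

/-- The `2n`-form `α^{∧ n} / n!` attached to a 2-form `α`.  Its `2n` arguments are indexed by
`Fin n × Fin 2`, in the order `(0,0), (0,1), (1,0), (1,1), …`; since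
`α^{∧ n}(v) = 2⁻ⁿ ∑_σ sign σ ∏_k α(v_{σ(k,0)}, v_{σ(k,1)})`, this is the Pfaffian of `α` on `v`. -/
def liouvilleForm {V : Type*} [AddCommGroup V] [Module ℝ V] [TopologicalSpace V] {n : ℕ}
    (α : V [⋀^Fin 2]→L[ℝ] ℝ) (v : Fin n × Fin 2 → V) : ℝ :=
  ((n.factorial : ℝ) * 2 ^ n)⁻¹ * ∑ σ : Equiv.Perm (Fin n × Fin 2),
    ((Equiv.Perm.sign σ : ℤ) : ℝ) * ∏ k : Fin n, α ![v (σ (k, 0)), v (σ (k, 1))]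

/-- The standard real basis `e₁, i e₁, …, eₙ, i eₙ` of `ℂⁿ`, which is positively oriented. -/
def standardRealBasis (n : ℕ) (p : Fin n × Fin 2) : Fin n → ℂ :=
  Pi.single p.1 (![1, Complex.I] p.2)

/-- The measure on `M` carried by the domain of the chart `φ` and given there by the volume form
`Ω^{∧ n} / n!`: its density with respect to Lebesgue measure in the chart is the value of the form on
the standard basis (which is positive for a Kähler form `Ω`). -/
def liouvilleMeasureInChart [MeasurableSpace M]
    (Ω : Π x : M, TangentSpace 𝓘(ℝ, Fin n → ℂ) x [⋀^Fin 2]→L[ℝ] ℝ)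
    (φ : OpenPartialHomeomorph M (Fin n → ℂ)) : Measure M :=
  (((volume : Measure (Fin n → ℂ)).restrict φ.target).withDensity fun y =>
    ENNReal.ofReal |liouvilleForm (formInChart Ω φ y) (standardRealBasis n)|).map φ.symm

/-- The measure `A ↦ ∫_A Ω^{∧ n} / n!` on `M`.  The measures in the charts agree on overlaps, and the
supremum (in the lattice of measures) glues them. -/
def liouvilleMeasure [MeasurableSpace M]
    (Ω : Π x : M, TangentSpace 𝓘(ℝ, Fin n → ℂ) x [⋀^Fin 2]→L[ℝ] ℝ) : Measure M :=
  ⨆ φ ∈ atlas (Fin n → ℂ) M, liouvilleMeasureInChart Ω φ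

end Forms

/-! ### Quantum line bundles -/

section LineBundle

variable {n : ℕ} {M : Type*} [TopologicalSpace M] [ChartedSpace (Fin n → ℂ) M]
  {L : M → Type*} [∀ x, NormedAddCommGroup (L x)] [∀ x, InnerProductSpace ℂ (L x)]
  [TopologicalSpace (TotalSpace ℂ L)] [FiberBundle ℂ L]

variable (n) in
/-- A smooth global section of the line bundle `L`. -/
def IsSmoothSection (σ : Π x : M, L x) : Prop :=
  ContMDiff 𝓘(ℝ, Fin n → ℂ) (𝓘(ℝ, Fin n → ℂ).prod 𝓘(ℝ, ℂ)) ∞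
    (fun x => (⟨x, σ x⟩ : TotalSpace ℂ L))

variable (n) in
/-- The section `σ` of the line bundle `L` is holomorphic in a neighbourhood of `x`. -/
def IsHolomorphicSectionAt (σ : Π x : M, L x) (x : M) : Prop :=
  ContMDiffAt 𝓘(ℂ, Fin n → ℂ) (𝓘(ℂ, Fin n → ℂ).prod 𝓘(ℂ, ℂ)) ω
    (fun x => (⟨x, σ x⟩ : TotalSpace ℂ L)) x

/-- A smooth real vector field on `M`. -/
def IsSmoothVectorField [IsManifold 𝓘(ℂ, Fin n → ℂ) ω M]
    (X : Π x : M, TangentSpace 𝓘(ℝ, Fin n → ℂ) x) : Prop :=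
  ContMDiff 𝓘(ℝ, Fin n → ℂ) (𝓘(ℝ, Fin n → ℂ).prod 𝓘(ℝ, Fin n → ℂ)) ∞
    (fun x => (⟨x, X x⟩ : TangentBundle 𝓘(ℝ, Fin n → ℂ) M))

/-- `(L, h, ∇)` is a quantum line bundle for `(M, Ω)`.  Here `L` is a holomorphic line bundle, the
Hermitian metric `h` is the family of inner products of the fibres (antilinear in the first argument),
and `∇_X σ (x)` is written `D σ x (X x)`. -/
structure IsQuantumLineBundle [IsManifold 𝓘(ℂ, Fin n → ℂ) ω M]
    [VectorBundle ℂ ℂ L] [ContMDiffVectorBundle ω ℂ L 𝓘(ℂ, Fin n → ℂ)]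
    (Ω : Π x : M, TangentSpace 𝓘(ℝ, Fin n → ℂ) x [⋀^Fin 2]→L[ℝ] ℝ)
    (D : CovariantDerivative 𝓘(ℝ, Fin n → ℂ) ℂ L) : Prop where
  /-- `h` is smooth: in the holomorphic frame given by a local trivialization it is represented by
  a smooth function. -/
  metric_smooth : ∀ (e : Trivialization ℂ (TotalSpace.proj : TotalSpace ℂ L → M))
    [MemTrivializationAtlas e],
    ContMDiffOn 𝓘(ℝ, Fin n → ℂ) 𝓘(ℝ, ℝ) ∞ (fun x => ‖e.symm x 1‖ ^ 2) e.baseSet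
  /-- `∇` is complex linear. -/
  connection_smul : ∀ (c : ℂ) (σ : Π x : M, L x), IsSmoothSection n σ →
    ∀ (x : M) (v : TangentSpace 𝓘(ℝ, Fin n → ℂ) x), D (fun y => c • σ y) x v = c • D σ x v
  /-- `∇` is smooth. -/
  connection_smooth : ∀ X : Π x : M, TangentSpace 𝓘(ℝ, Fin n → ℂ) x, IsSmoothVectorField X →
    ∀ σ : Π x : M, L x, IsSmoothSection n σ → IsSmoothSection n (fun x => D σ x (X x))
  /-- `∇` is compatible with the metric: `v (h(σ, τ)) = h(∇_v σ, τ) + h(σ, ∇_v τ)`. -/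
  compatible_metric : ∀ σ τ : Π x : M, L x, IsSmoothSection n σ → IsSmoothSection n τ →
    ∀ (x : M) (v : TangentSpace 𝓘(ℝ, Fin n → ℂ) x),
      mvfderiv 𝓘(ℝ, Fin n → ℂ) (fun y => inner ℂ (σ y) (τ y)) x v =
        inner ℂ (D σ x v) (τ x) + inner ℂ (σ x) (D τ x v)
  /-- `∇` is compatible with the complex structure: `∇_{Jv} σ = i ∇_v σ` for `σ` holomorphic,
  that is, `∇^{0,1} = ∂̄`. -/
  compatible_complex : ∀ (σ : Π x : M, L x) (x : M), IsHolomorphicSectionAt n σ x →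
    ∀ v : TangentSpace 𝓘(ℝ, Fin n → ℂ) x, D σ x (almostComplex x v) = Complex.I • D σ x v
  /-- The prequantum condition `∇_X ∇_Y - ∇_Y ∇_X - ∇_{[X,Y]} = -i Ω(X, Y)`. -/
  curvature : ∀ X Y : Π x : M, TangentSpace 𝓘(ℝ, Fin n → ℂ) x,
    IsSmoothVectorField X → IsSmoothVectorField Y →
    ∀ σ : Π x : M, L x, IsSmoothSection n σ → ∀ x : M,
      D (fun y => D σ y (Y y)) x (X x) - D (fun y => D σ y (X y)) x (Y x)
          - D σ x (VectorField.mlieBracket 𝓘(ℝ, Fin n → ℂ) X Y x) =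
        (-(Complex.I * (Ω x ![X x, Y x] : ℂ))) • σ x

/-! ### Tensor powers of the line bundle

The fibre of `L^m` at `x` is the `m`-th tensor power `⨂[ℂ]^m (L x)`.  A trivialization `e` of `L`
induces the trivialization `v₁ ⊗ ⋯ ⊗ v_m ↦ e(v₁) ⋯ e(v_m)` of `L^m`, and these define the holomorphic
and the smooth structure of `L^m`. -/

/-- The coordinate on the fibre of `L^m` at `x` in the trivialization induced by a trivialization `e`
of `L`. -/
def powCoord [VectorBundle ℂ ℂ L] (m : ℕ)
    (e : Trivialization ℂ (TotalSpace.proj : TotalSpace ℂ L → M)) [MemTrivializationAtlas e]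
    (x : M) : ⨂[ℂ]^m (L x) →ₗ[ℂ] ℂ :=
  PiTensorProduct.lift
    ((MultilinearMap.mkPiAlgebra ℂ (Fin m) ℂ).compLinearMap fun _ => e.linearMapAt ℂ x)

/-- The Hermitian metric `h^{(m)}` on the fibre of `L^m` at `x`, antilinear in the first argument.  It is
the one with `h^{(m)}(⊗ vᵢ, ⊗ wᵢ) = ∏ h(vᵢ, wᵢ)`, see `powHermitian_tprod`. -/
def powHermitian [VectorBundle ℂ ℂ L] (m : ℕ) (x : M) (u v : ⨂[ℂ]^m (L x)) : ℂ :=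
  conj (powCoord m (trivializationAt ℂ L x) x u) * powCoord m (trivializationAt ℂ L x) x v *
    (inner ℂ ((trivializationAt ℂ L x).symm x 1) ((trivializationAt ℂ L x).symm x 1)) ^ m

theorem powHermitian_tprod [VectorBundle ℂ ℂ L] (m : ℕ) (x : M) (v w : Fin m → L x) :
    powHermitian m x (PiTensorProduct.tprod ℂ v) (PiTensorProduct.tprod ℂ w) =
      ∏ i, inner ℂ (v i) (w i) := by
  have hx : x ∈ (trivializationAt ℂ L x).baseSet := mem_baseSet_trivializationAt ℂ L x
  have key : ∀ u : L x, u = ((trivializationAt ℂ L x).linearMapAt ℂ x u) •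
      (trivializationAt ℂ L x).symm x 1 := by
    intro u
    have h1 := (trivializationAt ℂ L x).symmₗ_linearMapAt (R := ℂ) hx u
    conv_lhs => rw [← h1]
    conv_lhs => rw [← mul_one ((trivializationAt ℂ L x).linearMapAt ℂ x u), ← smul_eq_mul, map_smul]
    rw [Trivialization.symmₗ_apply _ hx]
  have h2 : ∀ i, inner ℂ (v i) (w i) =
      conj ((trivializationAt ℂ L x).linearMapAt ℂ x (v i)) *
        (trivializationAt ℂ L x).linearMapAt ℂ x (w i) *
        inner ℂ ((trivializationAt ℂ L x).symm x 1) ((trivializationAt ℂ L x).symm x 1) := by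
    intro i
    conv_lhs => rw [key (v i), key (w i)]
    rw [inner_smul_left, inner_smul_right]
    ring
  simp only [h2, Finset.prod_mul_distrib, powHermitian, powCoord, PiTensorProduct.lift.tprod,
    MultilinearMap.compLinearMap_apply, MultilinearMap.mkPiAlgebra_apply, map_prod,
    Finset.prod_const, Finset.card_univ, Fintype.card_fin]

variable (n L) in
/-- The space of global `C^∞` sections of `L^m`. -/
def smoothSections [VectorBundle ℂ ℂ L] (m : ℕ) : Submodule ℂ (Π x : M, ⨂[ℂ]^m (L x)) where
  carrier := {s | ∀ (e : Trivialization ℂ (TotalSpace.proj : TotalSpace ℂ L → M))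
    [MemTrivializationAtlas e],
    ContMDiffOn 𝓘(ℝ, Fin n → ℂ) 𝓘(ℝ, ℂ) ∞ (fun x => powCoord m e x (s x)) e.baseSet}
  add_mem' hs ht e _ := by
    simp only [Pi.add_apply, map_add]
    exact ContMDiffOn.add (hs e) (ht e)
  zero_mem' e _ := by
    simpa only [Pi.zero_apply, map_zero] using contMDiffOn_const
  smul_mem' c s hs e _ := by
    simp only [Pi.smul_apply, map_smul]
    exact (contDiff_const_smul c).contMDiff.comp_contMDiffOn (hs e)

variable (n L) in
/-- The space `Γ_hol(M, L^m)` of global holomorphic sections of `L^m`. -/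
def holomorphicSections [VectorBundle ℂ ℂ L] (m : ℕ) : Submodule ℂ (Π x : M, ⨂[ℂ]^m (L x)) where
  carrier := {s | ∀ (e : Trivialization ℂ (TotalSpace.proj : TotalSpace ℂ L → M))
    [MemTrivializationAtlas e],
    ContMDiffOn 𝓘(ℂ, Fin n → ℂ) 𝓘(ℂ, ℂ) ω (fun x => powCoord m e x (s x)) e.baseSet}
  add_mem' hs ht e _ := by
    simp only [Pi.add_apply, map_add]
    exact ContMDiffOn.add (hs e) (ht e)
  zero_mem' e _ := by
    simpa only [Pi.zero_apply, map_zero] using contMDiffOn_const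
  smul_mem' c s hs e _ := by
    simp only [Pi.smul_apply, map_smul]
    exact (contDiff_const_smul c).contMDiff.comp_contMDiffOn (hs e)

/-! ### The Toeplitz operators -/

variable [MeasurableSpace M] [VectorBundle ℂ ℂ L]
  (Ω : Π x : M, TangentSpace 𝓘(ℝ, Fin n → ℂ) x [⋀^Fin 2]→L[ℝ] ℝ) {m : ℕ}

/-- The scalar product `⟨φ, ψ⟩ = ∫_M h^{(m)}(φ, ψ) Ω^{∧ n} / n!` of sections of `L^m`. -/
def sectionInner (φ ψ : Π x : M, ⨂[ℂ]^m (L x)) : ℂ :=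
  ∫ x, powHermitian m x (φ x) (ψ x) ∂(liouvilleMeasure Ω)

/-- The holomorphic section `t` is the orthogonal projection of the section `ψ` to `Γ_hol(M, L^m)`:
the difference `ψ - t` is orthogonal to every holomorphic section. -/
def IsOrthogonalProjection (ψ : Π x : M, ⨂[ℂ]^m (L x)) (t : holomorphicSections n L m) : Prop :=
  ∀ u : holomorphicSections n L m, sectionInner Ω u.1 (ψ - t.1) = 0

open Classical in
/-- The orthogonal projection `Π^{(m)}` to `Γ_hol(M, L^m)`. -/
def holomorphicProjection (ψ : Π x : M, ⨂[ℂ]^m (L x)) : holomorphicSections n L m :=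
  if h : ∃ t, IsOrthogonalProjection Ω ψ t then h.choose else 0

/-- The Toeplitz operator `T_f^{(m)} : s ↦ Π^{(m)}(f · s)` on `Γ_hol(M, L^m)`. -/
def toeplitzOperator (f : smoothFunctions n M) (s : holomorphicSections n L m) :
    holomorphicSections n L m :=
  holomorphicProjection Ω (fun x => f.1 x • s.1 x)

end LineBundle

end

/-!
The Liouville measure is finite and charges every nonempty open set, so `⟨·, ·⟩` is positive definite on
smooth sections.  In a chart the density of the measure is the Pfaffian of the form, which transforms with the
determinant (`liouvilleForm_comp`, `liouvilleMeasureInChart_eq`) and does not vanish for a positive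
`(1,1)`-form (`liouvilleForm_standardRealBasis_ne_zero`), as one sees in a unitary frame.

The space of holomorphic sections of `L^m` is finite-dimensional
(`finiteDimensional_holomorphicSections`).  By the Schwarz lemma a section that vanishes at `x` is, near
`x`, at most half as large as its maximum over `M`, on a neighbourhood independent of the section.
Finitely many such neighbourhoods cover `M`, so a section that vanishes at their centres is zero.
Hence orthogonal projections exist and are unique, and the Toeplitz operators are bilinear in `(f, s)`.

For surjectivity, let `(bᵢ)` be a basis of the space of holomorphic sections.  An operator `B` is
determined by the matrix `⟨bᵢ, B bⱼ⟩`, and for `B = T_f` this is `∫ f h(bᵢ, bⱼ)`.  If the matrices of the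
Toeplitz operators did not fill the matrix space, there would be coefficients `aᵢⱼ`, not all zero, such
that `K = ∑ aᵢⱼ h(bᵢ, bⱼ)` satisfies `∫ f K = 0` for all smooth `f`; with `f = conj K` one gets `K = 0`.
In a holomorphic frame this reads `∑ aᵢⱼ conj(gᵢ(z)) gⱼ(z) = 0`, and polarization
(`sum_conj_mul_eq_zero_of_diagonal`) separates the variables: `∑ aᵢⱼ conj(gᵢ(w)) gⱼ(z) = 0` for all `z`, `w`
in a ball.  By the identity theorem on the connected manifold `M`
(`holomorphicSection_eq_zero_of_eventually`) and the linear independence of the `bᵢ`, all `aᵢⱼ` vanish.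
-/

noncomputable section

/-! ### The Liouville form of a positive `(1,1)`-form -/

section TwoForms

variable {V : Type*} [AddCommGroup V] [Module ℝ V] [TopologicalSpace V] (α : V [⋀^Fin 2]→L[ℝ] ℝ)

theorem twoForm_swap (v w : V) : α ![w, v] = -α ![v, w] := by
  have e : ![v, w] ∘ Equiv.swap (0 : Fin 2) 1 = ![w, v] := by
    ext i : 1
    fin_cases i <;> rfl
  have h := α.toAlternatingMap.map_swap ![v, w] (i := 0) (j := 1) (by decide)
  rw [e] at h
  exact h

theorem twoForm_add_left (u v w : V) : α ![u + v, w] = α ![u, w] + α ![v, w] := by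
  have e : ∀ x, Function.update ![u, w] 0 x = ![x, w] := fun x => by
    ext i : 1
    fin_cases i <;> rfl
  have h := α.map_update_add ![u, w] 0 u v
  rwa [e, e, e] at h

theorem twoForm_smul_left (c : ℝ) (v w : V) : α ![c • v, w] = c * α ![v, w] := by
  have e : ∀ x, Function.update ![v, w] 0 x = ![x, w] := fun x => by
    ext i : 1
    fin_cases i <;> rfl
  have h := α.map_update_smul ![v, w] 0 c v
  rwa [e, e] at h

theorem twoForm_add_right (u v w : V) : α ![u, v + w] = α ![u, v] + α ![u, w] := by
  rw [twoForm_swap, twoForm_add_left, twoForm_swap α u v, twoForm_swap α u w]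
  ring

theorem twoForm_smul_right (c : ℝ) (v w : V) : α ![v, c • w] = c * α ![v, w] := by
  rw [twoForm_swap, twoForm_smul_left, twoForm_swap α v w]
  ring

end TwoForms

section LinearAlgebra

variable {n : ℕ}

/-- The map `v ↦ ∏ₖ α(v₍ₖ,₀₎, v₍ₖ,₁₎)`, whose alternatization is `2ⁿ n!` times the Liouville form. -/
def pairingProduct {V : Type*} [AddCommGroup V] [Module ℝ V] [TopologicalSpace V]
    (n : ℕ) (α : V [⋀^Fin 2]→L[ℝ] ℝ) : MultilinearMap ℝ (fun _ : Fin n × Fin 2 => V) ℝ :=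
  MultilinearMap.mk' (fun v => ∏ k : Fin n, α ![v (k, 0), v (k, 1)])
    (by
      rintro v ⟨k, j⟩ x y
      have hne : ∀ z, ∀ l ∈ Finset.univ.erase k,
          α ![Function.update v (k, j) z (l, 0), Function.update v (k, j) z (l, 1)] =
            α ![v (l, 0), v (l, 1)] := by
        intro z l hl
        have : l ≠ k := (Finset.mem_erase.1 hl).1
        simp [this]
      simp only [← Finset.mul_prod_erase _ _ (Finset.mem_univ k)]
      rw [Finset.prod_congr rfl (hne x), Finset.prod_congr rfl (hne y),
        Finset.prod_congr rfl (hne (x + y)), ← add_mul]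
      congr 1
      fin_cases j
      · simpa [Function.update_apply] using twoForm_add_left α _ _ _
      · simpa [Function.update_apply] using twoForm_add_right α _ _ _)
    (by
      rintro v ⟨k, j⟩ c x
      have hne : ∀ z, ∀ l ∈ Finset.univ.erase k,
          α ![Function.update v (k, j) z (l, 0), Function.update v (k, j) z (l, 1)] =
            α ![v (l, 0), v (l, 1)] := by
        intro z l hl
        have : l ≠ k := (Finset.mem_erase.1 hl).1
        simp [this]
      simp only [← Finset.mul_prod_erase _ _ (Finset.mem_univ k)]
      rw [Finset.prod_congr rfl (hne x), Finset.prod_congr rfl (hne (c • x)), smul_eq_mul,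
        ← mul_assoc]
      congr 1
      fin_cases j
      · simpa [Function.update_apply] using twoForm_smul_left α _ _ _
      · simpa [Function.update_apply] using twoForm_smul_right α _ _ _)

/-- The Liouville form of a 2-form as an alternating map. -/
def liouvilleAlternating {V : Type*} [AddCommGroup V] [Module ℝ V] [TopologicalSpace V]
    (n : ℕ) (α : V [⋀^Fin 2]→L[ℝ] ℝ) : V [⋀^Fin n × Fin 2]→ₗ[ℝ] ℝ :=
  ((n.factorial : ℝ) * 2 ^ n)⁻¹ • MultilinearMap.alternatization (pairingProduct n α)

theorem liouvilleAlternating_apply {V : Type*} [AddCommGroup V] [Module ℝ V] [TopologicalSpace V]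
    (α : V [⋀^Fin 2]→L[ℝ] ℝ) (v : Fin n × Fin 2 → V) :
    liouvilleAlternating n α v = liouvilleForm α v := by
  rw [liouvilleAlternating, AlternatingMap.smul_apply, MultilinearMap.alternatization_apply,
    liouvilleForm, smul_eq_mul]
  congr 1
  refine Finset.sum_congr rfl fun σ _ => ?_
  rw [Units.smul_def, zsmul_eq_mul]
  rfl

variable (n) in
/-- `standardRealBasis` as a basis of the real vector space `ℂⁿ`. -/
def standardBasis : Module.Basis (Fin n × Fin 2) ℝ (Fin n → ℂ) :=
  (Pi.basis fun _ : Fin n => Complex.basisOneI).reindex (Equiv.sigmaEquivProd _ _)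

theorem coe_standardBasis : ⇑(standardBasis n) = standardRealBasis n := by
  ext ⟨k, j⟩ l
  simp [standardBasis, standardRealBasis, Pi.basis_apply]

theorem liouvilleForm_comp (α : (Fin n → ℂ) [⋀^Fin 2]→L[ℝ] ℝ) (A : (Fin n → ℂ) →L[ℝ] (Fin n → ℂ)) :
    liouvilleForm (α.compContinuousLinearMap A) (standardRealBasis n) =
      A.det * liouvilleForm α (standardRealBasis n) := by
  have h1 : liouvilleForm (α.compContinuousLinearMap A) (standardRealBasis n) =
      liouvilleForm α (A ∘ standardRealBasis n) := by
    simp only [liouvilleForm]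
    congr 1
    refine Finset.sum_congr rfl fun σ _ => ?_
    congr 1
    refine Finset.prod_congr rfl fun k _ => ?_
    rw [ContinuousAlternatingMap.compContinuousLinearMap_apply]
    congr 1
    ext i : 1
    fin_cases i <;> rfl
  rw [h1, ← liouvilleAlternating_apply, ← liouvilleAlternating_apply,
    (liouvilleAlternating n α).eq_smul_basis_det (standardBasis n), ← coe_standardBasis]
  simp only [AlternatingMap.smul_apply, smul_eq_mul]
  have := (standardBasis n).det_comp (A : (Fin n → ℂ) →ₗ[ℝ] (Fin n → ℂ)) (standardBasis n)
  rw [Module.Basis.det_self, mul_one] at this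
  rw [Module.Basis.det_self, mul_one]
  erw [this]
  rw [mul_comm]

theorem exists_orthonormal_basis_of_core {V : Type*} [AddCommGroup V] [Module ℂ V]
    [FiniteDimensional ℂ V] (core : InnerProductSpace.Core ℂ V) {n : ℕ}
    (hn : Module.finrank ℂ V = n) :
    ∃ e : Fin n → V, ∀ i j, core.inner (e i) (e j) = if i = j then 1 else 0 := by
  let := core.toNormedAddCommGroup
  let := InnerProductSpace.ofCore core.toCore
  exact ⟨(stdOrthonormalBasis ℂ V).reindex (finCongr hn),
    orthonormal_iff_ite.1 ((stdOrthonormalBasis ℂ V).reindex (finCongr hn)).orthonormal⟩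

/-- On a unitary frame `e₁, i e₁, …, eₙ, i eₙ` the sum over the permutations that defines the Liouville
form has only nonnegative terms: those that do not vanish belong to permutations of the blocks
composed with permutations inside the blocks, whose signs cancel. -/
theorem liouvilleForm_pos_of_frame {V : Type*} [AddCommGroup V] [Module ℝ V] [TopologicalSpace V]
    (α : V [⋀^Fin 2]→L[ℝ] ℝ) (v : Fin n × Fin 2 → V)
    (h01 : ∀ k l, α ![v (k, 0), v (l, 1)] = if k = l then 1 else 0)
    (h00 : ∀ k l, α ![v (k, 0), v (l, 0)] = 0) (h11 : ∀ k l, α ![v (k, 1), v (l, 1)] = 0) :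
    0 < liouvilleForm α v := by
  have h10 : ∀ k l, α ![v (k, 1), v (l, 0)] = if k = l then -1 else 0 := by
    intro k l
    rw [twoForm_swap, h01]
    split_ifs <;> simp_all
  have hpair : ∀ p q : Fin n × Fin 2, α ![v p, v q] ≠ 0 → p.1 = q.1 ∧ p.2 ≠ q.2 := by
    rintro ⟨k, i⟩ ⟨l, j⟩ h
    fin_cases i <;> fin_cases j <;> simp_all
  have hsign : ∀ (k : Fin n) (ε : Equiv.Perm (Fin 2)),
      α ![v (k, ε 0), v (k, ε 1)] = ((Equiv.Perm.sign ε : ℤ) : ℝ) := by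
    intro k ε
    have : ε = 1 ∨ ε = Equiv.swap 0 1 := by
      revert ε
      decide
    rcases this with rfl | rfl
    · simp [h01]
    · rw [Equiv.Perm.sign_swap (by decide)]
      simp [h10]
  have hnonneg : ∀ σ : Equiv.Perm (Fin n × Fin 2), 0 ≤ ((Equiv.Perm.sign σ : ℤ) : ℝ) *
      ∏ k : Fin n, α ![v (σ (k, 0)), v (σ (k, 1))] := by
    intro σ
    by_cases h : ∏ k : Fin n, α ![v (σ (k, 0)), v (σ (k, 1))] = 0
    · rw [h, mul_zero]
    have hk : ∀ k, (σ (k, 0)).1 = (σ (k, 1)).1 ∧ (σ (k, 0)).2 ≠ (σ (k, 1)).2 := fun k =>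
      hpair _ _ (Finset.prod_ne_zero_iff.1 h k (Finset.mem_univ k))
    have hε : ∀ k, Function.Injective fun j => (σ (k, j)).2 := by
      intro k i j hij
      have h2 := (hk k).2
      fin_cases i <;> fin_cases j
      · rfl
      · exact absurd hij h2
      · exact absurd hij.symm h2
      · rfl
    have hfst : ∀ k j, (σ (k, j)).1 = (σ (k, 0)).1 := by
      intro k j
      fin_cases j
      · rfl
      · exact (hk k).1.symm
    let ε : Fin n → Equiv.Perm (Fin 2) := fun k =>
      Equiv.ofBijective _ (Finite.injective_iff_bijective.1 (hε k))
    have h_surj : Function.Surjective fun k => (σ (k, 0)).1 := by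
      intro l
      refine ⟨(σ.symm (l, 0)).1, ?_⟩
      change (σ ((σ.symm (l, 0)).1, 0)).1 = l
      rw [← hfst _ (σ.symm (l, 0)).2]
      simp
    let τ : Equiv.Perm (Fin n) := Equiv.ofBijective _ (Finite.surjective_iff_bijective.1 h_surj)
    have hσ : σ = (Equiv.prodCongrLeft fun _ : Fin 2 => τ) * Equiv.prodCongrRight ε := by
      ext1 ⟨k, j⟩
      refine Prod.ext ?_ ?_
      · exact hfst k j
      · rfl
    have hs : ((Equiv.Perm.sign σ : ℤ) : ℝ) = ∏ k, ((Equiv.Perm.sign (ε k) : ℤ) : ℝ) := by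
      rw [hσ, map_mul, Equiv.Perm.sign_prodCongrLeft, Equiv.Perm.sign_prodCongrRight,
        Fin.prod_univ_two, Int.units_mul_self, one_mul]
      push_cast
      rfl
    have hp : ∏ k : Fin n, α ![v (σ (k, 0)), v (σ (k, 1))] =
        ∏ k, ((Equiv.Perm.sign (ε k) : ℤ) : ℝ) := by
      refine Finset.prod_congr rfl fun k _ => ?_
      rw [← hsign (τ k) (ε k), hσ]
      rfl
    rw [hs, hp]
    exact mul_self_nonneg _
  refine mul_pos (by positivity) (Finset.sum_pos' (fun σ _ => hnonneg σ) ⟨1, Finset.mem_univ _, ?_⟩)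
  simp [h01]

/-- The Liouville form of a positive `(1,1)`-form on `ℂⁿ` does not vanish. -/
theorem liouvilleForm_standardRealBasis_ne_zero (α : (Fin n → ℂ) [⋀^Fin 2]→L[ℝ] ℝ)
    (h11 : ∀ v w : Fin n → ℂ, α ![Complex.I • v, Complex.I • w] = α ![v, w])
    (hpos : ∀ v : Fin n → ℂ, v ≠ 0 → 0 < α ![v, Complex.I • v]) :
    liouvilleForm α (standardRealBasis n) ≠ 0 := by
  have hswap := twoForm_swap α
  have hadd := twoForm_add_left α
  have hsmul := twoForm_smul_left α
  have hII : ∀ v : Fin n → ℂ, Complex.I • Complex.I • v = (-1 : ℝ) • v := fun v => by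
    ext i
    simp [← mul_assoc]
  have hI : ∀ v w, α ![Complex.I • v, w] = - α ![v, Complex.I • w] := by
    intro v w
    rw [← h11 v, hII, hswap ((-1 : ℝ) • w), hsmul, hswap (Complex.I • v)]
    ring
  have hc : ∀ (c : ℂ) v w, α ![c • v, w] = c.re * α ![v, w] - c.im * α ![v, Complex.I • w] := by
    intro c v w
    have : c • v = c.re • v + c.im • (Complex.I • v) := by
      ext i
      conv_lhs => rw [← Complex.re_add_im c]
      simp only [Pi.smul_apply, Pi.add_apply, smul_eq_mul, Complex.real_smul]
      ring
    rw [this, hadd, hsmul, hsmul, hI]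
    ring
  -- The Hermitian form `H(v, w) = α(v, iw) + i α(v, w)` is positive definite.
  let core : InnerProductSpace.Core ℂ (Fin n → ℂ) :=
    { inner := fun v w => (α ![v, Complex.I • w] : ℂ) + Complex.I * α ![v, w]
      conj_inner_symm := fun v w => by
        have : α ![w, Complex.I • v] = α ![v, Complex.I • w] := by
          rw [hswap, hI, neg_neg]
        simp only [map_add, map_mul, Complex.conj_ofReal, Complex.conj_I, this, hswap v w]
        push_cast
        ring
      re_inner_nonneg := fun v => by
        by_cases hv : v = 0
        · subst hv
          have h0 : ∀ w, α ![0, w] = 0 := fun w => by simpa using hsmul 0 0 w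
          simp [h0]
        · simpa using (hpos v hv).le
      add_left := fun u v w => by
        simp only [hadd]
        push_cast
        ring
      smul_left := fun v w c => by
        have h3 : α ![v, (-1 : ℝ) • w] = - α ![v, w] := by
          rw [hswap, hsmul, hswap v w]
          ring
        simp only [hc, hII, h3]
        apply Complex.ext
        · simp
        · simp
          ring
      definite := fun v hv => by
        by_contra h
        have := congrArg Complex.re hv
        simp at this
        exact (hpos v h).ne' this }
  obtain ⟨e, he⟩ := exists_orthonormal_basis_of_core core (n := n) (by simp)
  have hre : ∀ k l, α ![e k, Complex.I • e l] = if k = l then 1 else 0 := by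
    intro k l
    have : ((α ![e k, Complex.I • e l] : ℂ) + Complex.I * α ![e k, e l]).re = _ :=
      congrArg Complex.re (he k l)
    split_ifs at this ⊢ <;> simpa using this
  have him : ∀ k l, α ![e k, e l] = 0 := by
    intro k l
    have : ((α ![e k, Complex.I • e l] : ℂ) + Complex.I * α ![e k, e l]).im = _ :=
      congrArg Complex.im (he k l)
    split_ifs at this <;> simpa using this
  have hp := liouvilleForm_pos_of_frame α (fun p => ![e p.1, Complex.I • e p.1] p.2)
    (by simpa using hre) (by simpa using him) (by simpa [h11] using him)
  intro h0
  rw [← coe_standardBasis, ← liouvilleAlternating_apply,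
    AlternatingMap.map_basis_eq_zero_iff] at h0
  rw [← liouvilleAlternating_apply, h0] at hp
  simp at hp

end LinearAlgebra

/-! ### The Liouville measure -/

section Measure

theorem measurableSet_preimage_symm_inter_target {n : ℕ} {M : Type*}
    [TopologicalSpace M] [MeasurableSpace M] [BorelSpace M] (φ : OpenPartialHomeomorph M (Fin n → ℂ))
    {A : Set M} (hA : MeasurableSet A) : MeasurableSet (φ.symm ⁻¹' A ∩ φ.target) := by
  have h : Measurable (φ.target.domRestrict φ.symm) :=
    (continuousOn_iff_continuous_domRestrict.1 φ.continuousOn_symm).measurable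
  have := (MeasurableEmbedding.subtype_coe φ.open_target.measurableSet).measurableSet_image.2
    (h hA)
  convert this using 1
  ext y
  simp [Set.domRestrict, and_comm]

variable {n : ℕ} {M : Type*} [TopologicalSpace M] [ChartedSpace (Fin n → ℂ) M]

theorem isManifold_real_one [IsManifold 𝓘(ℂ, Fin n → ℂ) ω M] :
    IsManifold 𝓘(ℝ, Fin n → ℂ) 1 M :=
  IsManifold.of_le (n := ω) le_top

theorem liouvilleForm_formInChart_ne_zero [IsManifold 𝓘(ℂ, Fin n → ℂ) ω M]
    {Ω : Π x : M, TangentSpace 𝓘(ℝ, Fin n → ℂ) x [⋀^Fin 2]→L[ℝ] ℝ} (hΩ : IsKahlerForm Ω)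
    {φ : OpenPartialHomeomorph M (Fin n → ℂ)} (hφ : φ ∈ atlas (Fin n → ℂ) M)
    {y : Fin n → ℂ} (hy : y ∈ φ.target) :
    liouvilleForm (formInChart Ω φ y) (standardRealBasis n) ≠ 0 := by
  have := isManifold_real_one (n := n) (M := M)
  -- The tangent space at `φ.symm y` is a copy of `ℂⁿ`, and the chart identifies it with `ℂⁿ` by an
  -- invertible real linear map `A`, so positivity can be used in the tangent space itself.
  let α : (Fin n → ℂ) [⋀^Fin 2]→L[ℝ] ℝ := Ω (φ.symm y)
  let A : (Fin n → ℂ) →L[ℝ] (Fin n → ℂ) :=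
    mfderiv 𝓘(ℝ, Fin n → ℂ) 𝓘(ℝ, Fin n → ℂ) φ.symm y
  have h : formInChart Ω φ y = α.compContinuousLinearMap A := rfl
  rw [h, liouvilleForm_comp]
  refine mul_ne_zero ?_ (liouvilleForm_standardRealBasis_ne_zero α
    (hΩ.type_one_one (φ.symm y)) (hΩ.positive (φ.symm y)))
  have hinj : Function.Injective A :=
    (mdifferentiable_of_mem_atlas hφ).symm.mfderiv_injective (x := y) hy
  have := (LinearEquiv.ofInjectiveEndo (A : (Fin n → ℂ) →ₗ[ℝ] (Fin n → ℂ)) hinj).isUnit_det'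
  exact this.ne_zero

/-- The change of chart formula for a 2-form. -/
theorem formInChart_eq_comp_fderiv [IsManifold 𝓘(ℂ, Fin n → ℂ) ω M]
    (Ω : Π x : M, TangentSpace 𝓘(ℝ, Fin n → ℂ) x [⋀^Fin 2]→L[ℝ] ℝ)
    {φ ψ : OpenPartialHomeomorph M (Fin n → ℂ)} (hφ : φ ∈ atlas (Fin n → ℂ) M)
    (hψ : ψ ∈ atlas (Fin n → ℂ) M) {y : Fin n → ℂ} (hy : y ∈ φ.target)
    (hy' : φ.symm y ∈ ψ.source) :
    DifferentiableAt ℝ (ψ ∘ φ.symm) y ∧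
    formInChart Ω φ y =
      (formInChart Ω ψ (ψ (φ.symm y))).compContinuousLinearMap (fderiv ℝ (ψ ∘ φ.symm) y) := by
  have := isManifold_real_one (n := n) (M := M)
  have h1 := (mdifferentiable_of_mem_atlas (I := 𝓘(ℝ, Fin n → ℂ)) hφ).mdifferentiableAt_symm hy
  have h2 := (mdifferentiable_of_mem_atlas (I := 𝓘(ℝ, Fin n → ℂ)) hψ).mdifferentiableAt hy'
  have h3 := h2.comp y h1
  have h4 := (mdifferentiable_of_mem_atlas (I := 𝓘(ℝ, Fin n → ℂ)) hψ).mdifferentiableAt_symm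
    (ψ.map_source hy')
  have heq : φ.symm =ᶠ[nhds y] ψ.symm ∘ (ψ ∘ φ.symm) := by
    have : φ.symm ⁻¹' ψ.source ∈ nhds y :=
      (φ.symm.continuousAt hy).preimage_mem_nhds (ψ.open_source.mem_nhds hy')
    filter_upwards [this] with z hz
    exact (ψ.left_inv hz).symm
  refine ⟨h3.differentiableAt, ?_⟩
  have hm : HasMFDerivAt 𝓘(ℝ, Fin n → ℂ) 𝓘(ℝ, Fin n → ℂ) φ.symm y
      ((mfderiv 𝓘(ℝ, Fin n → ℂ) 𝓘(ℝ, Fin n → ℂ) ψ.symm (ψ (φ.symm y))).comp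
        (mfderiv 𝓘(ℝ, Fin n → ℂ) 𝓘(ℝ, Fin n → ℂ) (ψ ∘ φ.symm) y)) :=
    (HasMFDerivAt.comp y h4.hasMFDerivAt h3.hasMFDerivAt).congr_of_eventuallyEq heq
  have hd := hm.mfderiv
  have hpt : ψ.symm (ψ (φ.symm y)) = φ.symm y := ψ.left_inv hy'
  have hform : ∀ x : M, x = φ.symm y → ∀ v : Fin 2 → (Fin n → ℂ),
      (Ω x : (Fin n → ℂ) [⋀^Fin 2]→L[ℝ] ℝ) v =
        (Ω (φ.symm y) : (Fin n → ℂ) [⋀^Fin 2]→L[ℝ] ℝ) v := by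
    rintro x rfl v
    rfl
  ext v
  rw [← mfderiv_eq_fderiv]
  simp only [formInChart]
  refine Eq.trans ?_ (hform _ hpt _).symm
  change (Ω (φ.symm y)) (_ ∘ _) = _
  rw [hd]
  rfl

theorem continuousOn_liouvilleForm_formInChart
    {Ω : Π x : M, TangentSpace 𝓘(ℝ, Fin n → ℂ) x [⋀^Fin 2]→L[ℝ] ℝ} (hΩ : IsKahlerForm Ω)
    {φ : OpenPartialHomeomorph M (Fin n → ℂ)} (hφ : φ ∈ atlas (Fin n → ℂ) M) :
    ContinuousOn (fun y => liouvilleForm (formInChart Ω φ y) (standardRealBasis n)) φ.target := by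
  have h := (hΩ.smooth φ hφ).continuousOn
  have hv : ∀ v : Fin 2 → (Fin n → ℂ), ContinuousOn (fun y => formInChart Ω φ y v) φ.target :=
    fun v => (continuous_eval_const v).comp_continuousOn h
  refine continuousOn_const.mul (continuousOn_finsetSum _ fun σ _ => ?_)
  exact continuousOn_const.mul (continuousOn_finsetProd _ fun k _ => hv _)

variable [MeasurableSpace M] [BorelSpace M]

theorem liouvilleMeasureInChart_apply
    (Ω : Π x : M, TangentSpace 𝓘(ℝ, Fin n → ℂ) x [⋀^Fin 2]→L[ℝ] ℝ)
    (φ : OpenPartialHomeomorph M (Fin n → ℂ)) {A : Set M} (hA : MeasurableSet A) :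
    liouvilleMeasureInChart Ω φ A = ∫⁻ y in φ.symm ⁻¹' A ∩ φ.target,
      ENNReal.ofReal |liouvilleForm (formInChart Ω φ y) (standardRealBasis n)| := by
  -- Off the target of the chart `φ.symm` is arbitrary; almost everywhere measurability for the
  -- restricted measure is what makes the pushforward meaningful.
  have hae : AEMeasurable φ.symm ((volume : Measure (Fin n → ℂ)).restrict φ.target) :=
    φ.continuousOn_symm.aemeasurable φ.open_target.measurableSet
  rw [liouvilleMeasureInChart,
    Measure.map_apply_of_aemeasurable (hae.mono_ac (withDensity_absolutelyContinuous _ _)) hA,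
    withDensity_apply', Measure.restrict_restrict' φ.open_target.measurableSet]

/-- The measures given in two charts by a 2-form agree on the overlap. -/
theorem liouvilleMeasureInChart_eq [IsManifold 𝓘(ℂ, Fin n → ℂ) ω M]
    (Ω : Π x : M, TangentSpace 𝓘(ℝ, Fin n → ℂ) x [⋀^Fin 2]→L[ℝ] ℝ)
    {φ ψ : OpenPartialHomeomorph M (Fin n → ℂ)} (hφ : φ ∈ atlas (Fin n → ℂ) M)
    (hψ : ψ ∈ atlas (Fin n → ℂ) M) {A : Set M} (hA : MeasurableSet A) (hAφ : A ⊆ φ.source)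
    (hAψ : A ⊆ ψ.source) : liouvilleMeasureInChart Ω φ A = liouvilleMeasureInChart Ω ψ A := by
  rw [liouvilleMeasureInChart_apply Ω φ hA, liouvilleMeasureInChart_apply Ω ψ hA]
  have himg : ψ.symm ⁻¹' A ∩ ψ.target = (ψ ∘ φ.symm) '' (φ.symm ⁻¹' A ∩ φ.target) := by
    ext z
    constructor
    · rintro ⟨hz, hz'⟩
      refine ⟨φ (ψ.symm z), ⟨?_, φ.map_source (hAφ hz)⟩, ?_⟩
      · simpa [φ.left_inv (hAφ hz)] using hz
      · simp [φ.left_inv (hAφ hz), ψ.right_inv hz']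
    · rintro ⟨y, ⟨hy, hy'⟩, rfl⟩
      refine ⟨?_, ψ.map_source (hAψ hy)⟩
      simpa [ψ.left_inv (hAψ hy)] using hy
  have hinj : Set.InjOn (ψ ∘ φ.symm) (φ.symm ⁻¹' A ∩ φ.target) := by
    rintro y ⟨hy, hy'⟩ z ⟨hz, hz'⟩ h
    exact φ.symm.injOn hy' hz' (ψ.injOn (hAψ hy) (hAψ hz) h)
  have hms := measurableSet_preimage_symm_inter_target φ hA
  rw [himg, lintegral_image_eq_lintegral_abs_det_fderiv_mul volume hms
    (fun y hy => (formInChart_eq_comp_fderiv Ω hφ hψ hy.2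
      (hAψ hy.1)).1.hasFDerivAt.hasFDerivWithinAt) hinj]
  refine setLIntegral_congr_fun hms fun y hy => ?_
  rw [(formInChart_eq_comp_fderiv Ω hφ hψ hy.2 (hAψ hy.1)).2, liouvilleForm_comp, abs_mul,
    ENNReal.ofReal_mul (abs_nonneg _)]
  rfl

theorem liouvilleMeasureInChart_lt_top_of_isCompact [T2Space M]
    {Ω : Π x : M, TangentSpace 𝓘(ℝ, Fin n → ℂ) x [⋀^Fin 2]→L[ℝ] ℝ} (hΩ : IsKahlerForm Ω)
    {φ : OpenPartialHomeomorph M (Fin n → ℂ)} (hφ : φ ∈ atlas (Fin n → ℂ) M)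
    {K : Set M} (hK : IsCompact K) (hKφ : K ⊆ φ.source) :
    liouvilleMeasureInChart Ω φ K < ⊤ := by
  rw [liouvilleMeasureInChart_apply Ω φ hK.measurableSet]
  have himg : φ.symm ⁻¹' K ∩ φ.target = φ '' K := by
    rw [φ.image_eq_target_inter_inv_preimage hKφ, Set.inter_comm]
  have hcomp : IsCompact (φ '' K) := hK.image_of_continuousOn (φ.continuousOn.mono hKφ)
  have hsub : φ '' K ⊆ φ.target := himg ▸ Set.inter_subset_right
  rw [himg]
  have hc := (continuousOn_liouvilleForm_formInChart hΩ hφ).mono hsub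
  obtain ⟨C, hC⟩ := hcomp.exists_bound_of_continuousOn hc
  refine (setLIntegral_mono' hcomp.measurableSet (g := fun _ => ENNReal.ofReal C)
    fun y hy => ENNReal.ofReal_le_ofReal (hC y hy)).trans_lt ?_
  rw [setLIntegral_const]
  exact ENNReal.mul_lt_top ENNReal.ofReal_lt_top hcomp.measure_lt_top

/-- The Liouville measure of a compact manifold is finite.  The supremum of the chart measures is
bounded by the sum of the chart measures restricted to compact pieces of finitely many charts. -/
theorem isFiniteMeasure_liouvilleMeasure [T2Space M] [CompactSpace M]
    [IsManifold 𝓘(ℂ, Fin n → ℂ) ω M]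
    {Ω : Π x : M, TangentSpace 𝓘(ℝ, Fin n → ℂ) x [⋀^Fin 2]→L[ℝ] ℝ} (hΩ : IsKahlerForm Ω) :
    IsFiniteMeasure (liouvilleMeasure Ω) := by
  have : LocallyCompactSpace M := ChartedSpace.locallyCompactSpace (Fin n → ℂ) M
  have hK : ∀ x : M, ∃ K ∈ nhds x, K ⊆ (chartAt (Fin n → ℂ) x).source ∧ IsCompact K := fun x =>
    local_compact_nhds ((chartAt (Fin n → ℂ) x).open_source.mem_nhds (mem_chart_source _ x))
  choose K hKx hKs hKc using hK
  obtain ⟨t, ht⟩ := CompactSpace.elim_nhds_subcover K hKx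
  -- The atlas may be uncountable, so the supremum over it is bounded by a measure that involves only
  -- finitely many charts.
  let ν : Measure M := Measure.sum fun x : t =>
    (liouvilleMeasureInChart Ω (chartAt (Fin n → ℂ) x.1)).restrict (K x.1)
  have hle : liouvilleMeasure Ω ≤ ν := by
    refine iSup₂_le fun φ hφ => Measure.le_iff.2 fun A hA => ?_
    have h0 : liouvilleMeasureInChart Ω φ A = liouvilleMeasureInChart Ω φ (A ∩ φ.source) := by
      have hAs := hA.inter φ.open_source.measurableSet
      rw [liouvilleMeasureInChart_apply Ω φ hA, liouvilleMeasureInChart_apply Ω φ hAs]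
      congr 2
      ext y
      constructor
      · rintro ⟨h1, h2⟩
        exact ⟨⟨h1, φ.map_target h2⟩, h2⟩
      · rintro ⟨⟨h1, -⟩, h2⟩
        exact ⟨h1, h2⟩
    rw [h0]
    have hcov : A ∩ φ.source ⊆ ⋃ x : t, A ∩ φ.source ∩ K x.1 := by
      intro y hy
      have : y ∈ ⋃ x ∈ t, K x := ht ▸ Set.mem_univ y
      simp only [Set.mem_iUnion] at this ⊢
      obtain ⟨x, hx, hxy⟩ := this
      exact ⟨⟨x, hx⟩, hy, hxy⟩
    refine (measure_mono hcov).trans ((measure_iUnion_le _).trans ?_)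
    rw [Measure.sum_apply _ hA]
    refine ENNReal.tsum_le_tsum fun x => ?_
    rw [Measure.restrict_apply hA]
    have hm : MeasurableSet (A ∩ φ.source ∩ K x.1) :=
      (hA.inter φ.open_source.measurableSet).inter (hKc x.1).measurableSet
    rw [liouvilleMeasureInChart_eq Ω hφ (chart_mem_atlas (Fin n → ℂ) x.1) hm
      (fun y hy => hy.1.2) (fun y hy => hKs _ hy.2)]
    exact measure_mono fun y hy => ⟨hy.1.1, hy.2⟩
  refine ⟨(hle Set.univ).trans_lt ?_⟩
  rw [Measure.sum_apply _ MeasurableSet.univ, tsum_fintype]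
  refine ENNReal.sum_lt_top.2 fun x _ => ?_
  rw [Measure.restrict_apply_univ]
  exact liouvilleMeasureInChart_lt_top_of_isCompact hΩ (chart_mem_atlas _ _) (hKc x.1) (hKs x.1)

theorem isOpenPosMeasure_liouvilleMeasure [IsManifold 𝓘(ℂ, Fin n → ℂ) ω M]
    {Ω : Π x : M, TangentSpace 𝓘(ℝ, Fin n → ℂ) x [⋀^Fin 2]→L[ℝ] ℝ} (hΩ : IsKahlerForm Ω) :
    (liouvilleMeasure Ω).IsOpenPosMeasure := by
  refine ⟨fun U hU ⟨x, hx⟩ h0 => ?_⟩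
  let φ := chartAt (Fin n → ℂ) x
  have hφ : φ ∈ atlas (Fin n → ℂ) M := chart_mem_atlas _ x
  have hle : liouvilleMeasureInChart Ω φ ≤ liouvilleMeasure Ω :=
    le_iSup₂_of_le (f := fun φ (_ : φ ∈ atlas (Fin n → ℂ) M) => liouvilleMeasureInChart Ω φ)
      φ hφ le_rfl
  have h1 : liouvilleMeasureInChart Ω φ U = 0 := le_antisymm (h0 ▸ hle U) zero_le
  rw [liouvilleMeasureInChart_apply Ω φ hU.measurableSet] at h1
  have hopen : IsOpen (φ.symm ⁻¹' U ∩ φ.target) := by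
    rw [Set.inter_comm]
    exact φ.isOpen_inter_preimage_symm hU
  have hne : (φ.symm ⁻¹' U ∩ φ.target).Nonempty :=
    ⟨φ x, by simpa [φ] using hx, mem_chart_target _ x⟩
  have hmeas : AEMeasurable (fun y => ENNReal.ofReal
      |liouvilleForm (formInChart Ω φ y) (standardRealBasis n)|)
      (volume.restrict (φ.symm ⁻¹' U ∩ φ.target)) :=
    (((continuousOn_liouvilleForm_formInChart hΩ hφ).abs.mono
      Set.inter_subset_right).aemeasurable hopen.measurableSet).ennreal_ofReal
  rw [lintegral_eq_zero_iff' hmeas] at h1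
  have h2 := (ae_restrict_iff' hopen.measurableSet).1 h1
  refine hopen.measure_ne_zero volume hne ?_
  refine measure_mono_null ?_ h2
  intro y hy hy'
  have := hy' hy
  simp only [Pi.zero_apply, ENNReal.ofReal_eq_zero, abs_nonpos_iff] at this
  exact liouvilleForm_formInChart_ne_zero hΩ hφ hy.2 this

end Measure

/-! ### Sections of the tensor powers in local frames -/

section Fibres

variable {n : ℕ} {M : Type*} [TopologicalSpace M] [ChartedSpace (Fin n → ℂ) M]
  {L : M → Type*} [∀ x, NormedAddCommGroup (L x)] [∀ x, InnerProductSpace ℂ (L x)]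
  [TopologicalSpace (TotalSpace ℂ L)] [FiberBundle ℂ L] [VectorBundle ℂ ℂ L]

section

variable (e : Trivialization ℂ (TotalSpace.proj : TotalSpace ℂ L → M)) [MemTrivializationAtlas e]
  (e' : Trivialization ℂ (TotalSpace.proj : TotalSpace ℂ L → M)) [MemTrivializationAtlas e']

theorem linearMapAt_smul_symm_one {x : M} (hx : x ∈ e.baseSet) (u : L x) :
    e.linearMapAt ℂ x u • e.symm x 1 = u := by
  conv_rhs => rw [← e.symmₗ_linearMapAt (R := ℂ) hx u]
  conv_rhs => rw [← mul_one (e.linearMapAt ℂ x u), ← smul_eq_mul, map_smul]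
  rw [Trivialization.symmₗ_apply _ hx]

theorem symm_one_ne_zero {x : M} (hx : x ∈ e.baseSet) : e.symm x (1 : ℂ) ≠ 0 := by
  intro h
  have h1 := e.linearMapAt_symmₗ (R := ℂ) hx (1 : ℂ)
  rw [Trivialization.symmₗ_apply _ hx, h, map_zero] at h1
  exact zero_ne_one h1

theorem powCoord_tprod (m : ℕ) (x : M) (v : Fin m → L x) :
    powCoord m e x (PiTensorProduct.tprod ℂ v) = ∏ i, e.linearMapAt ℂ x (v i) := by
  simp only [powCoord, PiTensorProduct.lift.tprod, MultilinearMap.compLinearMap_apply,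
    MultilinearMap.mkPiAlgebra_apply]

/-- The frame `e⁻¹(1)^{⊗ m}` spans the fibre of `L^m`. -/
theorem powCoord_smul_tprod (m : ℕ) {x : M} (hx : x ∈ e.baseSet) (u : ⨂[ℂ]^m (L x)) :
    powCoord m e x u • PiTensorProduct.tprod ℂ (fun _ : Fin m => e.symm x (1 : ℂ)) = u := by
  have h : (powCoord m e x).smulRight
      (PiTensorProduct.tprod ℂ (fun _ : Fin m => e.symm x (1 : ℂ))) = LinearMap.id := by
    refine PiTensorProduct.ext (MultilinearMap.ext fun v => ?_)
    simp only [LinearMap.compMultilinearMap_apply, LinearMap.smulRight_apply, LinearMap.id_apply]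
    rw [powCoord_tprod, ← MultilinearMap.map_smul_univ]
    congr 1
    ext i
    exact linearMapAt_smul_symm_one e hx (v i)
  exact LinearMap.congr_fun h u

theorem powCoord_eq_zero_iff (m : ℕ) {x : M} (hx : x ∈ e.baseSet) {u : ⨂[ℂ]^m (L x)} :
    powCoord m e x u = 0 ↔ u = 0 := by
  refine ⟨fun h => ?_, fun h => by rw [h, map_zero]⟩
  rw [← powCoord_smul_tprod e m hx u, h, zero_smul]

theorem powCoord_eq_pow_mul (m : ℕ) {x : M} (hx' : x ∈ e'.baseSet) (u : ⨂[ℂ]^m (L x)) :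
    powCoord m e x u = e.linearMapAt ℂ x (e'.symm x 1) ^ m * powCoord m e' x u := by
  conv_lhs => rw [← powCoord_smul_tprod e' m hx' u, map_smul, powCoord_tprod]
  simp [mul_comm]

/-- The Hermitian metric of `L^m` in the frame given by any trivialization of `L`. -/
theorem powHermitian_eq (m : ℕ) {x : M} (hx : x ∈ e.baseSet) (u v : ⨂[ℂ]^m (L x)) :
    powHermitian m x u v =
      conj (powCoord m e x u) * powCoord m e x v * ((‖e.symm x (1 : ℂ)‖ ^ 2 : ℝ) : ℂ) ^ m := by
  have hx0 : x ∈ (trivializationAt ℂ L x).baseSet := mem_baseSet_trivializationAt ℂ L x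
  rw [powHermitian, powCoord_eq_pow_mul (trivializationAt ℂ L x) e m hx u,
    powCoord_eq_pow_mul (trivializationAt ℂ L x) e m hx v]
  conv_rhs => rw [← linearMapAt_smul_symm_one (trivializationAt ℂ L x) hx0 (e.symm x 1)]
  rw [inner_self_eq_norm_sq_to_K, norm_smul, map_mul, map_pow, mul_pow]
  push_cast
  rw [← Complex.conj_mul']
  simp only [RCLike.ofReal_eq_complex_ofReal]
  ring

end

theorem powHermitian_self_eq_zero_iff {m : ℕ} {x : M} {u : ⨂[ℂ]^m (L x)} :
    powHermitian m x u u = 0 ↔ u = 0 := by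
  have hx0 : x ∈ (trivializationAt ℂ L x).baseSet := mem_baseSet_trivializationAt ℂ L x
  rw [powHermitian_eq (trivializationAt ℂ L x) m hx0, ← powCoord_eq_zero_iff _ m hx0]
  have := symm_one_ne_zero _ hx0
  simp [this]

theorem powHermitian_add_right {m : ℕ} {x : M} (u v w : ⨂[ℂ]^m (L x)) :
    powHermitian m x u (v + w) = powHermitian m x u v + powHermitian m x u w := by
  simp only [powHermitian, map_add]
  ring

theorem powHermitian_smul_right {m : ℕ} {x : M} (c : ℂ) (u v : ⨂[ℂ]^m (L x)) :
    powHermitian m x u (c • v) = c * powHermitian m x u v := by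
  simp only [powHermitian, map_smul, smul_eq_mul]
  ring

theorem powHermitian_add_left {m : ℕ} {x : M} (u v w : ⨂[ℂ]^m (L x)) :
    powHermitian m x (u + v) w = powHermitian m x u w + powHermitian m x v w := by
  simp only [powHermitian, map_add]
  ring

theorem powHermitian_smul_left {m : ℕ} {x : M} (c : ℂ) (u v : ⨂[ℂ]^m (L x)) :
    powHermitian m x (c • u) v = conj c * powHermitian m x u v := by
  simp only [powHermitian, map_smul, smul_eq_mul, map_mul]
  ring

theorem powHermitian_self_eq_norm {m : ℕ} {x : M} (u : ⨂[ℂ]^m (L x)) :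
    powHermitian m x u u = (‖powHermitian m x u u‖ : ℂ) := by
  rw [powHermitian_eq (trivializationAt ℂ L x) m (mem_baseSet_trivializationAt ℂ L x),
    Complex.conj_mul']
  rw [norm_mul, norm_pow, norm_pow, Complex.norm_real, Complex.norm_real]
  simp

/-- A holomorphic section is given in a chart and a holomorphic frame by an analytic function. -/
theorem analyticOnNhd_powCoord [IsManifold 𝓘(ℂ, Fin n → ℂ) ω M] {m : ℕ}
    {s : Π x : M, ⨂[ℂ]^m (L x)} (hs : s ∈ holomorphicSections n L m)
    (e : Trivialization ℂ (TotalSpace.proj : TotalSpace ℂ L → M)) [MemTrivializationAtlas e]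
    {φ : OpenPartialHomeomorph M (Fin n → ℂ)} (hφ : φ ∈ atlas (Fin n → ℂ) M) :
    AnalyticOnNhd ℂ (fun z => powCoord m e (φ.symm z) (s (φ.symm z)))
      (φ.target ∩ φ.symm ⁻¹' e.baseSet) := by
  have h1 : ContMDiffOn 𝓘(ℂ, Fin n → ℂ) 𝓘(ℂ, ℂ) ω
      ((fun x => powCoord m e x (s x)) ∘ φ.symm) (φ.target ∩ φ.symm ⁻¹' e.baseSet) :=
    (hs e).comp ((contMDiffOn_symm_of_mem_maximalAtlas
      (IsManifold.subset_maximalAtlas hφ)).mono Set.inter_subset_left) fun _ h => h.2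
  have hopen : IsOpen (φ.target ∩ φ.symm ⁻¹' e.baseSet) :=
    φ.isOpen_inter_preimage_symm e.open_baseSet
  exact (hopen.analyticOn_iff_analyticOnNhd).1 (contMDiffOn_iff_contDiffOn.1 h1).analyticOn

/-- Holomorphic functions on a complex manifold are smooth. -/
theorem contMDiffAt_real_of_complex [IsManifold 𝓘(ℂ, Fin n → ℂ) ω M] {f : M → ℂ} {x : M}
    (hf : ContMDiffAt 𝓘(ℂ, Fin n → ℂ) 𝓘(ℂ, ℂ) ω f x) :
    ContMDiffAt 𝓘(ℝ, Fin n → ℂ) 𝓘(ℝ, ℂ) ∞ f x := by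
  rw [contMDiffAt_iff] at hf ⊢
  refine ⟨hf.1, ?_⟩
  exact (ContDiffWithinAt.restrict_scalars ℝ hf.2).of_le le_top

theorem holomorphicSections_le_smoothSections [IsManifold 𝓘(ℂ, Fin n → ℂ) ω M] (m : ℕ) :
    holomorphicSections n L m ≤ smoothSections n L m := by
  intro s hs e _ x hx
  exact (contMDiffAt_real_of_complex
    ((hs e).contMDiffAt (e.open_baseSet.mem_nhds hx))).contMDiffWithinAt

theorem smul_mem_smoothSections {m : ℕ} (f : smoothFunctions n M) {s : Π x : M, ⨂[ℂ]^m (L x)}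
    (hs : s ∈ smoothSections n L m) : (fun x => f.1 x • s x) ∈ smoothSections n L m := by
  intro e _
  simp only [map_smul, smul_eq_mul]
  have hf : ContMDiff 𝓘(ℝ, Fin n → ℂ) 𝓘(ℝ, ℂ) ∞ f.1 := f.2
  exact (contDiff_mul (𝕜 := ℝ) (𝔸 := ℂ)).contMDiff.comp_contMDiffOn
    (hf.contMDiffOn.prodMk_space (hs e))

variable (n L) in
/-- The inner products of the fibres of `L` form a smooth Hermitian metric: in the frame given by any
trivialization the metric is represented by a smooth function. -/
def IsSmoothMetric : Prop :=
  ∀ (e : Trivialization ℂ (TotalSpace.proj : TotalSpace ℂ L → M)) [MemTrivializationAtlas e],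
    ContMDiffOn 𝓘(ℝ, Fin n → ℂ) 𝓘(ℝ, ℝ) ∞ (fun x => ‖e.symm x (1 : ℂ)‖ ^ 2) e.baseSet

/-- Pairing two smooth sections by `h^{(m)}` gives a smooth function. -/
theorem powHermitian_mem_smoothFunctions [IsManifold 𝓘(ℂ, Fin n → ℂ) ω M]
    (hmetric : IsSmoothMetric n L)
    {m : ℕ} {s t : Π x : M, ⨂[ℂ]^m (L x)} (hs : s ∈ smoothSections n L m)
    (ht : t ∈ smoothSections n L m) :
    (fun x => powHermitian m x (s x) (t x)) ∈ smoothFunctions n M := by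
  intro x
  let e := trivializationAt ℂ L x
  have hx : x ∈ e.baseSet := mem_baseSet_trivializationAt ℂ L x
  have hnhds := e.open_baseSet.mem_nhds hx
  let G : ℂ × ℂ × ℝ → ℂ := fun p => conj p.1 * p.2.1 * (p.2.2 : ℂ) ^ m
  have hG : ContDiff ℝ ∞ G := by
    have h1 : ContDiff ℝ ∞ fun p : ℂ × ℂ × ℝ => conj p.1 :=
      Complex.conjCLE.contDiff.comp contDiff_fst
    have h2 : ContDiff ℝ ∞ fun p : ℂ × ℂ × ℝ => (p.2.2 : ℂ) :=
      Complex.ofRealCLM.contDiff.comp (contDiff_snd.comp contDiff_snd)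
    exact (h1.mul (contDiff_fst.comp contDiff_snd)).mul (h2.pow m)
  have h3 : ContMDiffAt 𝓘(ℝ, Fin n → ℂ) 𝓘(ℝ, ℂ) ∞
      (G ∘ fun x => (powCoord m e x (s x), powCoord m e x (t x), ‖e.symm x (1 : ℂ)‖ ^ 2)) x :=
    hG.contMDiff.contMDiffAt.comp x (((hs e).contMDiffAt hnhds).prodMk_space
      (((ht e).contMDiffAt hnhds).prodMk_space ((hmetric e).contMDiffAt hnhds)))
  refine h3.congr_of_eventuallyEq ?_
  filter_upwards [hnhds] with y hy
  exact powHermitian_eq e m hy _ _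

end Fibres

/-! ### Holomorphic sections: identity theorem, finiteness, polarization -/

section Holomorphic

variable {n : ℕ}

/-- Polarization: a sum `∑ aᵢⱼ conj(gᵢ(w)) gⱼ(z)`, holomorphic in `z` and antiholomorphic in `w`, that
vanishes on the diagonal vanishes identically.  For given `z`, `w` there is a complex line
`t ↦ (c + t d, c + conj t d)` which is diagonal for real `t` and passes through `(z, w)` at `t = i`;
the identity theorem is applied on it. -/
theorem sum_conj_mul_eq_zero_of_diagonal {ι : Type*} [Fintype ι] {B : Set (Fin n → ℂ)}
    (hBo : IsOpen B) (hBc : Convex ℝ B) {g : ι → (Fin n → ℂ) → ℂ}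
    (hg : ∀ i, DifferentiableOn ℂ (g i) B) (a : ι → ι → ℂ)
    (h : ∀ z ∈ B, ∑ i, ∑ j, a i j * (conj (g i z) * g j z) = 0)
    {z w : Fin n → ℂ} (hz : z ∈ B) (hw : w ∈ B) :
    ∑ i, ∑ j, a i j * (conj (g i w) * g j z) = 0 := by
  let c : Fin n → ℂ := (1 / 2 : ℝ) • z + (1 / 2 : ℝ) • w
  let d : Fin n → ℂ := (-Complex.I / 2) • (z - w)
  let D₁ : Set ℂ := {t | c + t • d ∈ B}
  let D : Set ℂ := D₁ ∩ conj ⁻¹' D₁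
  have hcB : c ∈ B := hBc hz hw (by norm_num) (by norm_num) (by norm_num)
  -- On the line through `c` in the direction `d` the pair `(z, w)` is reached at the parameter `i`.
  have hzI : c + Complex.I • d = z := by
    ext k
    simp only [c, d, Pi.add_apply, Pi.smul_apply, smul_eq_mul, Complex.real_smul, Pi.sub_apply]
    push_cast
    linear_combination (-(z k - w k) / 2) * Complex.I_sq
  have hwI : c + conj Complex.I • d = w := by
    ext k
    simp only [c, d, Pi.add_apply, Pi.smul_apply, smul_eq_mul, Complex.real_smul, Pi.sub_apply,
      Complex.conj_I]
    push_cast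
    linear_combination ((z k - w k) / 2) * Complex.I_sq
  have hcont : Continuous fun t : ℂ => c + t • d := by fun_prop
  have hD₁o : IsOpen D₁ := hBo.preimage hcont
  have hDo : IsOpen D := hD₁o.inter (hD₁o.preimage Complex.continuous_conj)
  have hD₁c : Convex ℝ D₁ := by
    intro s hs t ht p q hp hq hpq
    have := hBc hs ht hp hq hpq
    change c + (p • s + q • t) • d ∈ B
    convert this using 1
    have hpq' : (p : ℂ) + q = 1 := by exact_mod_cast hpq
    ext k
    simp only [Pi.add_apply, Pi.smul_apply, smul_eq_mul, Complex.real_smul]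
    linear_combination (-c k) * hpq'
  have hDc : Convex ℝ D := hD₁c.inter (hD₁c.linear_preimage Complex.conjAe.toLinearMap)
  have h0 : (0 : ℂ) ∈ D := by simpa [D, D₁] using hcB
  have hI : Complex.I ∈ D :=
    ⟨by change _ ∈ B; rwa [hzI], by change _ ∈ B; rwa [hwI]⟩
  let F : ℂ → ℂ := fun t =>
    ∑ i, ∑ j, a i j * (conj (g i (c + conj t • d)) * g j (c + t • d))
  have hG : ∀ i, ∀ t ∈ D₁, DifferentiableAt ℂ (fun t : ℂ => g i (c + t • d)) t := fun i t ht =>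
    ((hg i).differentiableAt (hBo.mem_nhds ht)).comp t (by fun_prop)
  have hF : DifferentiableOn ℂ F D := by
    intro t ht
    refine DifferentiableAt.differentiableWithinAt (DifferentiableAt.fun_sum fun i _ =>
      DifferentiableAt.fun_sum fun j _ => ?_)
    refine (differentiableAt_const _).mul (DifferentiableAt.mul ?_ (hG j t ht.1))
    exact differentiableAt_conj_conj_iff.2 (hG i _ ht.2)
  have hreal : ∀ t : ℝ, (t : ℂ) ∈ D → F t = 0 := by
    intro t ht
    simpa [F] using h _ ht.1
  have hfreq : ∃ᶠ t in nhdsWithin (0 : ℂ) {0}ᶜ, F t = 0 := by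
    have ht : Filter.Tendsto (fun t : ℝ => (t : ℂ)) (nhdsWithin 0 {0}ᶜ)
        (nhdsWithin (0 : ℂ) {0}ᶜ) := by
      refine tendsto_nhdsWithin_iff.2 ⟨?_, ?_⟩
      · have := Complex.continuous_ofReal.tendsto 0
        simp only [Complex.ofReal_zero] at this
        exact this.mono_left nhdsWithin_le_nhds
      · filter_upwards [self_mem_nhdsWithin] with t ht
        simpa using ht
    refine ht.frequently (Filter.Eventually.frequently ?_)
    filter_upwards [ht.eventually (nhdsWithin_le_nhds (hDo.mem_nhds h0))] with t ht
    exact hreal t ht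
  have hzero := (hF.analyticOnNhd hDo).eqOn_zero_of_preconnected_of_frequently_eq_zero
    hDc.isPreconnected h0 hfreq hI
  simpa only [F, hzI, hwI, Pi.zero_apply] using hzero

/-- Every neighbourhood of a point contains a ball in the preferred chart at that point. -/
theorem exists_ball_subset_chart {M : Type*} [TopologicalSpace M]
    [ChartedSpace (Fin n → ℂ) M] (x : M) {W : Set M} (hW : W ∈ nhds x) :
    ∃ r > 0, Metric.ball (chartAt (Fin n → ℂ) x x) r ⊆
      (chartAt (Fin n → ℂ) x).target ∩ (chartAt (Fin n → ℂ) x).symm ⁻¹' W := by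
  refine Metric.mem_nhds_iff.1 (Filter.inter_mem (chart_target_mem_nhds _ x) ?_)
  refine ((chartAt (Fin n → ℂ) x).continuousAt_symm (mem_chart_target _ x)).preimage_mem_nhds ?_
  rwa [(chartAt (Fin n → ℂ) x).left_inv (mem_chart_source _ x)]

variable {M : Type*} [TopologicalSpace M] [ChartedSpace (Fin n → ℂ) M]
  [IsManifold 𝓘(ℂ, Fin n → ℂ) ω M]
  {L : M → Type*} [∀ x, NormedAddCommGroup (L x)] [∀ x, InnerProductSpace ℂ (L x)]
  [TopologicalSpace (TotalSpace ℂ L)] [FiberBundle ℂ L] [VectorBundle ℂ ℂ L] {m : ℕ}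

/-- The identity theorem for holomorphic sections. -/
theorem holomorphicSection_eq_zero_of_eventually [PreconnectedSpace M] {s : Π x : M, ⨂[ℂ]^m (L x)}
    (hs : s ∈ holomorphicSections n L m) {x₀ : M} (h : ∀ᶠ y in nhds x₀, s y = 0) : s = 0 := by
  let S : Set M := {x | ∀ᶠ y in nhds x, s y = 0}
  have hS : IsOpen S := isOpen_setOfPred_eventually_nhds
  have hScl : IsClosed S := by
    refine isClosed_of_closure_subset fun x hx => ?_
    let e := trivializationAt ℂ L x
    let φ := chartAt (Fin n → ℂ) x
    obtain ⟨r, hr, hB⟩ := exists_ball_subset_chart (n := n) x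
      (e.open_baseSet.mem_nhds (mem_baseSet_trivializationAt ℂ L x))
    have hg := (analyticOnNhd_powCoord hs e (chart_mem_atlas (Fin n → ℂ) x)).mono hB
    have hV : φ.source ∩ φ ⁻¹' Metric.ball (φ x) r ∈ nhds x :=
      Filter.inter_mem (chart_source_mem_nhds _ x)
        ((φ.continuousAt (mem_chart_source _ x)).preimage_mem_nhds (Metric.ball_mem_nhds _ hr))
    obtain ⟨y, hyV, hyS⟩ := mem_closure_iff_nhds.1 hx _ hV
    have hev : (fun z => powCoord m e (φ.symm z) (s (φ.symm z))) =ᶠ[nhds (φ y)] 0 := by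
      have h1 : Filter.Tendsto φ.symm (nhds (φ y)) (nhds y) := by
        have := φ.continuousAt_symm (φ.map_source hyV.1)
        rwa [ContinuousAt, φ.left_inv hyV.1] at this
      filter_upwards [h1.eventually hyS] with z hz
      rw [hz, map_zero, Pi.zero_apply]
    have hzero := hg.eqOn_zero_of_preconnected_of_eventuallyEq_zero
      (convex_ball (φ x) r).isPreconnected hyV.2 hev
    filter_upwards [hV] with z hz
    have hl : φ.symm (φ z) = z := φ.left_inv hz.1
    have h2 : powCoord m e (φ.symm (φ z)) (s (φ.symm (φ z))) = 0 := hzero hz.2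
    rw [← hl]
    exact (powCoord_eq_zero_iff e m (hB hz.2).2).1 h2
  have huniv : S = Set.univ := IsClopen.eq_univ ⟨hScl, hS⟩ ⟨x₀, h⟩
  funext x
  have : x ∈ S := huniv ▸ Set.mem_univ x
  exact this.self_of_nhds

/-- By the Schwarz lemma, a holomorphic section that vanishes at `x` has norm at most half its global
bound in a neighbourhood of `x` that does not depend on the section. -/
theorem exists_nhds_norm_le_half (hmetric : IsSmoothMetric n L) (x : M) :
    ∃ U ∈ nhds x, ∀ s ∈ holomorphicSections n L m, s x = 0 → ∀ C : ℝ, 0 < C →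
      (∀ y, ‖powHermitian m y (s y) (s y)‖ ≤ C) →
      ∀ y ∈ U, ‖powHermitian m y (s y) (s y)‖ ≤ C / 2 := by
  let e := trivializationAt ℂ L x
  let φ := chartAt (Fin n → ℂ) x
  have hx : x ∈ e.baseSet := mem_baseSet_trivializationAt ℂ L x
  let H : M → ℝ := fun y => (‖e.symm y (1 : ℂ)‖ ^ 2) ^ m
  have hH : ContinuousAt H x :=
    ((hmetric e).continuousOn.continuousAt (e.open_baseSet.mem_nhds hx)).pow m
  have hpos : 0 < H x := by
    have := symm_one_ne_zero e hx
    positivity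
  have hN : ∀ (s : Π x : M, ⨂[ℂ]^m (L x)), ∀ y ∈ e.baseSet,
      ‖powHermitian m y (s y) (s y)‖ = ‖powCoord m e y (s y)‖ ^ 2 * H y := by
    intro s y hy
    rw [powHermitian_eq e m hy, norm_mul, norm_mul, norm_pow, Complex.norm_real]
    simp [H, sq]
  -- Where the metric is within a factor of two of its value at `x`, the bound `C` on the norm of the
  -- section gives `‖g‖² ≤ 2 C / H x` for its coordinate `g`; the Schwarz lemma gains a factor `4` on the
  -- ball of a quarter of the radius.
  have hW : e.baseSet ∩ {y | H x / 2 < H y ∧ H y < 2 * H x} ∈ nhds x :=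
    Filter.inter_mem (e.open_baseSet.mem_nhds hx)
      ((hH.eventually (lt_mem_nhds (by linarith))).and (hH.eventually (gt_mem_nhds (by linarith))))
  obtain ⟨r, hr, hB⟩ := exists_ball_subset_chart (n := n) x hW
  refine ⟨φ.source ∩ φ ⁻¹' Metric.ball (φ x) (r / 4), Filter.inter_mem (chart_source_mem_nhds _ x)
    ((φ.continuousAt (mem_chart_source _ x)).preimage_mem_nhds
      (Metric.ball_mem_nhds _ (by positivity))), ?_⟩
  intro s hs hsx C hC hbound y hy
  let g : (Fin n → ℂ) → ℂ := fun z => powCoord m e (φ.symm z) (s (φ.symm z))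
  have hg : DifferentiableOn ℂ g (Metric.ball (φ x) r) :=
    ((analyticOnNhd_powCoord hs e (chart_mem_atlas (Fin n → ℂ) x)).mono
      fun z hz => ⟨(hB hz).1, (hB hz).2.1⟩).differentiableOn
  have hgx : g (φ x) = 0 := by
    have h1 : g (φ x) = powCoord m e x (s x) :=
      congrArg (fun y => powCoord m e y (s y)) (φ.left_inv (mem_chart_source (Fin n → ℂ) x))
    rw [h1, hsx, map_zero]
  have hmaps : Set.MapsTo g (Metric.ball (φ x) r)
      (Metric.closedBall (g (φ x)) (√(2 * C / H x))) := by
    intro z hz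
    rw [hgx, mem_closedBall_zero_iff]
    obtain ⟨-, hzb, hz1, -⟩ := hB hz
    have h1 := hbound (φ.symm z)
    rw [hN s _ hzb] at h1
    refine Real.le_sqrt_of_sq_le ?_
    rw [le_div_iff₀ hpos]
    have : ‖g z‖ ^ 2 * (H x / 2) ≤ ‖g z‖ ^ 2 * H (φ.symm z) :=
      mul_le_mul_of_nonneg_left hz1.le (sq_nonneg _)
    change ‖g z‖ ^ 2 * H (φ.symm z) ≤ C at h1
    linarith
  have hyr : φ y ∈ Metric.ball (φ x) r := Metric.ball_subset_ball (by linarith) hy.2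
  have hS := Complex.dist_le_div_mul_dist_of_mapsTo_ball hg hmaps hyr
  rw [hgx, dist_zero_right] at hS
  have hS' : ‖g (φ y)‖ ≤ √(2 * C / H x) / 4 := by
    refine hS.trans ?_
    have : dist (φ y) (φ x) ≤ r / 4 := (Metric.mem_ball.1 hy.2).le
    calc √(2 * C / H x) / r * dist (φ y) (φ x) ≤ √(2 * C / H x) / r * (r / 4) := by gcongr
      _ = √(2 * C / H x) / 4 := by field_simp
  obtain ⟨-, hyb, -, hy2⟩ := hB hyr
  have hl : φ.symm (φ y) = y := φ.left_inv hy.1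
  change φ.symm (φ y) ∈ e.baseSet at hyb
  change H (φ.symm (φ y)) < 2 * H x at hy2
  have hgy : g (φ y) = powCoord m e y (s y) :=
    congrArg (fun y => powCoord m e y (s y)) hl
  rw [hl] at hyb hy2
  rw [hN s y hyb, ← hgy]
  have hsq : ‖g (φ y)‖ ^ 2 ≤ 2 * C / H x / 16 := by
    calc ‖g (φ y)‖ ^ 2 ≤ (√(2 * C / H x) / 4) ^ 2 := by gcongr
      _ = 2 * C / H x / 16 := by
        rw [div_pow, Real.sq_sqrt (by positivity)]
        norm_num
  calc ‖g (φ y)‖ ^ 2 * H y ≤ 2 * C / H x / 16 * (2 * H x) := by gcongr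
    _ = C / 4 := by
      field_simp
      norm_num
    _ ≤ C / 2 := by linarith

/-- On a compact manifold the space of holomorphic sections of `L^m` is finite-dimensional: such a
section is determined by its values at finitely many points. -/
theorem finiteDimensional_holomorphicSections [CompactSpace M] [Nonempty M]
    (hmetric : IsSmoothMetric n L) :
    FiniteDimensional ℂ (holomorphicSections n L m) := by
  choose U hU hhalf using exists_nhds_norm_le_half (n := n) (m := m) hmetric
  obtain ⟨t, ht⟩ := CompactSpace.elim_nhds_subcover U hU
  let ev : holomorphicSections n L m →ₗ[ℂ] (t → ℂ) :=
    { toFun := fun s x => powCoord m (trivializationAt ℂ L x.1) x.1 (s.1 x.1)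
      map_add' := fun s s' => by
        ext x
        simp
      map_smul' := fun c s => by
        ext x
        simp }
  refine FiniteDimensional.of_injective ev ((injective_iff_map_eq_zero ev).2 fun s hs => ?_)
  have hsx : ∀ x ∈ t, s.1 x = 0 := fun x hx =>
    (powCoord_eq_zero_iff _ m (mem_baseSet_trivializationAt ℂ L x)).1 (congrFun hs ⟨x, hx⟩)
  have hsmooth := holomorphicSections_le_smoothSections m s.2
  have hcont : Continuous fun x => ‖powHermitian m x (s.1 x) (s.1 x)‖ := by
    have h : ContMDiff 𝓘(ℝ, Fin n → ℂ) 𝓘(ℝ, ℂ) ∞ fun x => powHermitian m x (s.1 x) (s.1 x) :=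
      powHermitian_mem_smoothFunctions hmetric hsmooth hsmooth
    exact h.continuous.norm
  obtain ⟨x₀, -, hmax⟩ := isCompact_univ.exists_isMaxOn Set.univ_nonempty hcont.continuousOn
  have hmax' : ∀ y, ‖powHermitian m y (s.1 y) (s.1 y)‖ ≤ ‖powHermitian m x₀ (s.1 x₀) (s.1 x₀)‖ :=
    fun y => hmax (Set.mem_univ y)
  have h0 : ‖powHermitian m x₀ (s.1 x₀) (s.1 x₀)‖ = 0 := by
    by_contra hne
    have hpos := lt_of_le_of_ne (norm_nonneg _) (Ne.symm hne)
    have : x₀ ∈ ⋃ x ∈ t, U x := ht ▸ Set.mem_univ x₀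
    simp only [Set.mem_iUnion] at this
    obtain ⟨x, hx, hxU⟩ := this
    have := hhalf x s.1 s.2 (hsx x hx) _ hpos hmax' x₀ hxU
    linarith
  ext x
  exact powHermitian_self_eq_zero_iff.1
    (norm_eq_zero.1 (le_antisymm (h0 ▸ hmax' x) (norm_nonneg _)))

end Holomorphic

/-! ### Independence of the functions `h(sᵢ, sⱼ)` -/

section Independence

variable {n : ℕ} {M : Type*} [TopologicalSpace M] [ChartedSpace (Fin n → ℂ) M]
  [IsManifold 𝓘(ℂ, Fin n → ℂ) ω M]
  {L : M → Type*} [∀ x, NormedAddCommGroup (L x)] [∀ x, InnerProductSpace ℂ (L x)]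
  [TopologicalSpace (TotalSpace ℂ L)] [FiberBundle ℂ L] [VectorBundle ℂ ℂ L] {m : ℕ}

/-- If a linear combination of linearly independent holomorphic sections has vanishing coordinate on a
chart ball, then it is trivial. -/
theorem coeff_eq_zero_of_powCoord_sum_eq_zero [PreconnectedSpace M] {ι : Type*} [Fintype ι]
    {b : ι → holomorphicSections n L m} (hb : LinearIndependent ℂ b) {x : M} {r : ℝ} (hr : 0 < r)
    (e : Trivialization ℂ (TotalSpace.proj : TotalSpace ℂ L → M)) [MemTrivializationAtlas e]
    (hB : Metric.ball (chartAt (Fin n → ℂ) x x) r ⊆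
      (chartAt (Fin n → ℂ) x).target ∩ (chartAt (Fin n → ℂ) x).symm ⁻¹' e.baseSet)
    {c : ι → ℂ} (hc : ∀ z ∈ Metric.ball (chartAt (Fin n → ℂ) x x) r,
      ∑ i, c i * powCoord m e ((chartAt (Fin n → ℂ) x).symm z)
        ((b i).1 ((chartAt (Fin n → ℂ) x).symm z)) = 0) : ∀ i, c i = 0 := by
  let φ := chartAt (Fin n → ℂ) x
  refine Fintype.linearIndependent_iff.1 hb c (Subtype.ext ?_)
  refine holomorphicSection_eq_zero_of_eventually (∑ i, c i • b i).2 (x₀ := x) ?_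
  have hV : φ.source ∩ φ ⁻¹' Metric.ball (φ x) r ∈ nhds x :=
    Filter.inter_mem (chart_source_mem_nhds _ x)
      ((φ.continuousAt (mem_chart_source _ x)).preimage_mem_nhds (Metric.ball_mem_nhds _ hr))
  filter_upwards [hV] with y hy
  have hl : φ.symm (φ y) = y := φ.left_inv hy.1
  rw [← hl]
  refine (powCoord_eq_zero_iff e m (hB hy.2).2).1 ?_
  rw [← hc (φ y) hy.2]
  simp [Finset.sum_apply, φ]

/-- For linearly independent holomorphic sections `sᵢ` the functions `h(sᵢ, sⱼ)` are linearly
independent. -/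
theorem coeff_eq_zero_of_sum_powHermitian_eq_zero [ConnectedSpace M] {ι : Type*} [Fintype ι]
    {b : ι → holomorphicSections n L m} (hb : LinearIndependent ℂ b) {a : ι → ι → ℂ}
    (ha : ∀ x, ∑ i, ∑ j, a i j * powHermitian m x ((b i).1 x) ((b j).1 x) = 0) :
    ∀ i j, a i j = 0 := by
  obtain ⟨x⟩ := (inferInstance : Nonempty M)
  let e := trivializationAt ℂ L x
  let φ := chartAt (Fin n → ℂ) x
  obtain ⟨r, hr, hB⟩ := exists_ball_subset_chart (n := n) x
    (e.open_baseSet.mem_nhds (mem_baseSet_trivializationAt ℂ L x))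
  let g : ι → (Fin n → ℂ) → ℂ := fun i z => powCoord m e (φ.symm z) ((b i).1 (φ.symm z))
  have hg : ∀ i, DifferentiableOn ℂ (g i) (Metric.ball (φ x) r) := fun i =>
    ((analyticOnNhd_powCoord (b i).2 e (chart_mem_atlas (Fin n → ℂ) x)).mono hB).differentiableOn
  have hdiag : ∀ z ∈ Metric.ball (φ x) r, ∑ i, ∑ j, a i j * (conj (g i z) * g j z) = 0 := by
    intro z hz
    have hz' : φ.symm z ∈ e.baseSet := (hB hz).2
    have h1 := ha (φ.symm z)
    have hne := symm_one_ne_zero e hz'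
    simp only [powHermitian_eq e m hz', ← mul_assoc (a _ _), ← Finset.sum_mul] at h1
    have hpos : ((‖e.symm (φ.symm z) (1 : ℂ)‖ ^ 2 : ℝ) : ℂ) ^ m ≠ 0 :=
      pow_ne_zero _ (by exact_mod_cast pow_ne_zero 2 (norm_ne_zero_iff.2 hne))
    have h2 := (mul_eq_zero.1 h1).resolve_right hpos
    simp only [mul_assoc] at h2
    exact h2
  -- For fixed `w` the polarized identity is a linear relation among the `gⱼ`; its coefficients vanish.
  -- Their conjugates are in turn linear relations among the `gᵢ`.
  have hpol : ∀ w ∈ Metric.ball (φ x) r, ∀ j, ∑ i, a i j * conj (g i w) = 0 := by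
    intro w hw
    refine coeff_eq_zero_of_powCoord_sum_eq_zero hb hr e hB fun z hz => ?_
    rw [← sum_conj_mul_eq_zero_of_diagonal Metric.isOpen_ball (convex_ball _ _) hg a hdiag hz hw,
      Finset.sum_comm]
    simp only [Finset.sum_mul, mul_assoc]
    rfl
  intro i j
  have hconj : ∀ i, conj (a i j) = 0 := by
    refine coeff_eq_zero_of_powCoord_sum_eq_zero hb hr e hB fun w hw => ?_
    have := congrArg conj (hpol w hw j)
    simpa only [map_sum, map_mul, Complex.conj_conj, map_zero] using this
  exact (map_eq_zero _).1 (hconj i)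

end Independence

/-! ### The scalar product of sections and the Toeplitz operators -/

section Toeplitz

variable {n : ℕ} {M : Type*} [TopologicalSpace M] [ChartedSpace (Fin n → ℂ) M]

theorem smoothFunctions.continuous {f : M → ℂ} (hf : f ∈ smoothFunctions n M) : Continuous f :=
  ContMDiff.continuous (n := ∞) (I := 𝓘(ℝ, Fin n → ℂ)) (I' := 𝓘(ℝ, ℂ)) hf

theorem conj_mem_smoothFunctions {f : M → ℂ} (hf : f ∈ smoothFunctions n M) :
    (fun x => conj (f x)) ∈ smoothFunctions n M :=
  Complex.conjCLE.contDiff.contMDiff.comp (n := ∞) (I := 𝓘(ℝ, Fin n → ℂ)) (I' := 𝓘(ℝ, ℂ)) hf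

variable [MeasurableSpace M]
  {Ω : Π x : M, TangentSpace 𝓘(ℝ, Fin n → ℂ) x [⋀^Fin 2]→L[ℝ] ℝ}
  {L : M → Type*} [∀ x, NormedAddCommGroup (L x)] [∀ x, InnerProductSpace ℂ (L x)]
  [TopologicalSpace (TotalSpace ℂ L)] [FiberBundle ℂ L] [VectorBundle ℂ ℂ L] {m : ℕ}

theorem sectionInner_smul_right (c : ℂ) (φ ψ : Π x : M, ⨂[ℂ]^m (L x)) :
    sectionInner Ω φ (c • ψ) = c * sectionInner Ω φ ψ := by
  simp only [sectionInner, Pi.smul_apply, powHermitian_smul_right]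
  exact integral_const_mul _ _

theorem sectionInner_smul_left (c : ℂ) (φ ψ : Π x : M, ⨂[ℂ]^m (L x)) :
    sectionInner Ω (c • φ) ψ = conj c * sectionInner Ω φ ψ := by
  simp only [sectionInner, Pi.smul_apply, powHermitian_smul_left]
  exact integral_const_mul _ _

theorem IsOrthogonalProjection.smul (c : ℂ) {ψ : Π x : M, ⨂[ℂ]^m (L x)}
    {t : holomorphicSections n L m} (ht : IsOrthogonalProjection Ω ψ t) :
    IsOrthogonalProjection Ω (c • ψ) (c • t) := by
  intro u
  rw [Submodule.coe_smul, ← smul_sub, sectionInner_smul_right, ht u, mul_zero]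

variable [T2Space M] [CompactSpace M] [IsManifold 𝓘(ℂ, Fin n → ℂ) ω M] [BorelSpace M]

theorem integrable_of_continuous (hΩ : IsKahlerForm Ω) {f : M → ℂ} (hf : Continuous f) :
    Integrable f (liouvilleMeasure Ω) := by
  have := isFiniteMeasure_liouvilleMeasure hΩ
  exact hf.integrable_of_hasCompactSupport (HasCompactSupport.of_compactSpace f)

/-- A continuous function with values in `[0, ∞)` whose integral vanishes is zero, because the Liouville
measure charges every nonempty open set. -/
theorem eq_zero_of_integral_eq_zero (hΩ : IsKahlerForm Ω) {f : M → ℂ} (hf : Continuous f)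
    (hpos : ∀ x, f x = (‖f x‖ : ℂ)) (h : ∫ x, f x ∂(liouvilleMeasure Ω) = 0) (x : M) : f x = 0 := by
  have := isFiniteMeasure_liouvilleMeasure hΩ
  have := isOpenPosMeasure_liouvilleMeasure hΩ
  have h1 : ∫ x, ‖f x‖ ∂(liouvilleMeasure Ω) = 0 := by
    rw [integral_congr_ae (Filter.Eventually.of_forall hpos), integral_complex_ofReal] at h
    exact_mod_cast h
  rw [integral_eq_zero_iff_of_nonneg (fun x => norm_nonneg _)
    (integrable_of_continuous hΩ hf).norm] at h1
  have h2 := (Continuous.ae_eq_iff_eq _ hf.norm continuous_const).1 h1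
  exact norm_eq_zero.1 (congrFun h2 x)

theorem integrable_powHermitian (hΩ : IsKahlerForm Ω)
    (hmetric : IsSmoothMetric n L) {φ ψ : Π x : M, ⨂[ℂ]^m (L x)} (hφ : φ ∈ smoothSections n L m)
    (hψ : ψ ∈ smoothSections n L m) :
    Integrable (fun x => powHermitian m x (φ x) (ψ x)) (liouvilleMeasure Ω) :=
  integrable_of_continuous hΩ
    (smoothFunctions.continuous (powHermitian_mem_smoothFunctions hmetric hφ hψ))

theorem sectionInner_add_right (hΩ : IsKahlerForm Ω)
    (hmetric : IsSmoothMetric n L) {φ ψ χ : Π x : M, ⨂[ℂ]^m (L x)} (hφ : φ ∈ smoothSections n L m)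
    (hψ : ψ ∈ smoothSections n L m) (hχ : χ ∈ smoothSections n L m) :
    sectionInner Ω φ (ψ + χ) = sectionInner Ω φ ψ + sectionInner Ω φ χ := by
  simp only [sectionInner, Pi.add_apply, powHermitian_add_right]
  exact integral_add (integrable_powHermitian hΩ hmetric hφ hψ)
    (integrable_powHermitian hΩ hmetric hφ hχ)

theorem sectionInner_add_left (hΩ : IsKahlerForm Ω)
    (hmetric : IsSmoothMetric n L) {φ ψ χ : Π x : M, ⨂[ℂ]^m (L x)} (hφ : φ ∈ smoothSections n L m)
    (hψ : ψ ∈ smoothSections n L m) (hχ : χ ∈ smoothSections n L m) :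
    sectionInner Ω (φ + ψ) χ = sectionInner Ω φ χ + sectionInner Ω ψ χ := by
  simp only [sectionInner, Pi.add_apply, powHermitian_add_left]
  exact integral_add (integrable_powHermitian hΩ hmetric hφ hχ)
    (integrable_powHermitian hΩ hmetric hψ hχ)

theorem sectionInner_sub_right (hΩ : IsKahlerForm Ω)
    (hmetric : IsSmoothMetric n L) {φ ψ χ : Π x : M, ⨂[ℂ]^m (L x)} (hφ : φ ∈ smoothSections n L m)
    (hψ : ψ ∈ smoothSections n L m) (hχ : χ ∈ smoothSections n L m) :
    sectionInner Ω φ (ψ - χ) = sectionInner Ω φ ψ - sectionInner Ω φ χ := by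
  rw [sub_eq_add_neg, ← neg_one_smul ℂ χ, sectionInner_add_right hΩ hmetric hφ hψ
    (Submodule.smul_mem _ _ hχ), sectionInner_smul_right]
  ring

theorem eq_zero_of_sectionInner_self (hΩ : IsKahlerForm Ω)
    (hmetric : IsSmoothMetric n L) {φ : Π x : M, ⨂[ℂ]^m (L x)} (hφ : φ ∈ smoothSections n L m)
    (h : sectionInner Ω φ φ = 0) : φ = 0 := by
  funext x
  exact powHermitian_self_eq_zero_iff.1 (eq_zero_of_integral_eq_zero hΩ
    (smoothFunctions.continuous (powHermitian_mem_smoothFunctions hmetric hφ hφ))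
    (fun x => powHermitian_self_eq_norm _) h x)

/-- The coordinates `t ↦ ⟨bᵢ, t⟩` of a holomorphic section with respect to a family `b`. -/
def gramMap (hΩ : IsKahlerForm Ω) (hmetric : IsSmoothMetric n L)
    {ι : Type*} (b : ι → holomorphicSections n L m) :
    holomorphicSections n L m →ₗ[ℂ] (ι → ℂ) where
  toFun t i := sectionInner Ω (b i).1 t.1
  map_add' s t := by
    ext i
    exact sectionInner_add_right hΩ hmetric (holomorphicSections_le_smoothSections m (b i).2)
      (holomorphicSections_le_smoothSections m s.2) (holomorphicSections_le_smoothSections m t.2)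
  map_smul' c t := by
    ext i
    exact sectionInner_smul_right c _ _

theorem sectionInner_eq_zero_of_basis (hΩ : IsKahlerForm Ω)
    (hmetric : IsSmoothMetric n L) {ι : Type*}
    (b : Module.Basis ι ℂ (holomorphicSections n L m)) {ψ : Π x : M, ⨂[ℂ]^m (L x)}
    (hψ : ψ ∈ smoothSections n L m) (h : ∀ i, sectionInner Ω (b i).1 ψ = 0)
    (u : holomorphicSections n L m) : sectionInner Ω u.1 ψ = 0 := by
  have hu : u ∈ Submodule.span ℂ (Set.range b) := b.mem_span u
  induction hu using Submodule.span_induction with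
  | mem x hx =>
    obtain ⟨i, rfl⟩ := hx
    exact h i
  | zero =>
    have := sectionInner_smul_left (Ω := Ω) (0 : ℂ) (0 : Π x : M, ⨂[ℂ]^m (L x)) ψ
    rw [zero_smul, map_zero, zero_mul] at this
    exact this
  | add x y _ _ hx hy =>
    have := sectionInner_add_left hΩ hmetric (holomorphicSections_le_smoothSections m x.2)
      (holomorphicSections_le_smoothSections m y.2) hψ
    rw [hx, hy, add_zero] at this
    exact this
  | smul c x _ hx =>
    have := sectionInner_smul_left (Ω := Ω) c x.1 ψ
    rw [hx, mul_zero] at this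
    exact this

theorem gramMap_injective (hΩ : IsKahlerForm Ω) (hmetric : IsSmoothMetric n L)
    {ι : Type*} (b : Module.Basis ι ℂ (holomorphicSections n L m)) :
    Function.Injective (gramMap hΩ hmetric b) := by
  refine (injective_iff_map_eq_zero _).2 fun t ht => Subtype.ext ?_
  have hts := holomorphicSections_le_smoothSections m t.2
  exact eq_zero_of_sectionInner_self hΩ hmetric hts
    (sectionInner_eq_zero_of_basis hΩ hmetric b hts (fun i => congrFun ht i) t)

theorem IsOrthogonalProjection.unique (hΩ : IsKahlerForm Ω)
    (hmetric : IsSmoothMetric n L) {ψ : Π x : M, ⨂[ℂ]^m (L x)} (hψ : ψ ∈ smoothSections n L m)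
    {t t' : holomorphicSections n L m} (ht : IsOrthogonalProjection Ω ψ t)
    (ht' : IsOrthogonalProjection Ω ψ t') : t = t' := by
  have hs : ∀ u : holomorphicSections n L m, u.1 ∈ smoothSections n L m := fun u =>
    holomorphicSections_le_smoothSections m u.2
  have h1 := ht (t - t')
  have h2 := ht' (t - t')
  rw [sectionInner_sub_right hΩ hmetric (hs _) hψ (hs _)] at h1 h2
  refine sub_eq_zero.1 (Subtype.ext (eq_zero_of_sectionInner_self hΩ hmetric (hs (t - t')) ?_))
  have h3 := sectionInner_sub_right hΩ hmetric (hs (t - t')) (hs t) (hs t')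
  refine h3.trans ?_
  linear_combination h2 - h1

theorem exists_isOrthogonalProjection (hΩ : IsKahlerForm Ω)
    (hmetric : IsSmoothMetric n L) [Nonempty M] {ψ : Π x : M, ⨂[ℂ]^m (L x)}
    (hψ : ψ ∈ smoothSections n L m) :
    ∃ t : holomorphicSections n L m, IsOrthogonalProjection Ω ψ t := by
  have := finiteDimensional_holomorphicSections (m := m) hmetric
  let b := Module.finBasis ℂ (holomorphicSections n L m)
  have hs : ∀ u : holomorphicSections n L m, u.1 ∈ smoothSections n L m := fun u =>
    holomorphicSections_le_smoothSections m u.2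
  have hsurj : Function.Surjective (gramMap hΩ hmetric b) :=
    (LinearMap.injective_iff_surjective_of_finrank_eq_finrank (by simp)).1
      (gramMap_injective hΩ hmetric b)
  obtain ⟨t, ht⟩ := hsurj fun i => sectionInner Ω (b i).1 ψ
  refine ⟨t, sectionInner_eq_zero_of_basis hΩ hmetric b (Submodule.sub_mem _ hψ (hs t))
    fun i => ?_⟩
  rw [sectionInner_sub_right hΩ hmetric (hs _) hψ (hs t), sub_eq_zero]
  exact (congrFun ht i).symm

theorem isOrthogonalProjection_toeplitzOperator (hΩ : IsKahlerForm Ω)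
    (hmetric : IsSmoothMetric n L) [Nonempty M] (f : smoothFunctions n M)
    (s : holomorphicSections n L m) :
    IsOrthogonalProjection Ω (fun x => f.1 x • s.1 x) (toeplitzOperator Ω f s) := by
  have h := exists_isOrthogonalProjection hΩ hmetric
    (smul_mem_smoothSections f (holomorphicSections_le_smoothSections m s.2))
  rw [toeplitzOperator, holomorphicProjection, dif_pos h]
  exact h.choose_spec

theorem IsOrthogonalProjection.add (hΩ : IsKahlerForm Ω)
    (hmetric : IsSmoothMetric n L) {φ ψ : Π x : M, ⨂[ℂ]^m (L x)} (hφ : φ ∈ smoothSections n L m)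
    (hψ : ψ ∈ smoothSections n L m) {s t : holomorphicSections n L m}
    (hs : IsOrthogonalProjection Ω φ s) (ht : IsOrthogonalProjection Ω ψ t) :
    IsOrthogonalProjection Ω (φ + ψ) (s + t) := by
  intro u
  have hu : ∀ u : holomorphicSections n L m, u.1 ∈ smoothSections n L m := fun u =>
    holomorphicSections_le_smoothSections m u.2
  have h := sectionInner_add_right hΩ hmetric (hu u) (Submodule.sub_mem _ hφ (hu s))
    (Submodule.sub_mem _ hψ (hu t))
  rw [hs u, ht u, add_zero] at h
  rw [← h, Submodule.coe_add, add_sub_add_comm]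

/-- The Toeplitz map `f ↦ T_f`. -/
def toeplitzMap (hΩ : IsKahlerForm Ω) (hmetric : IsSmoothMetric n L)
    [Nonempty M] :
    smoothFunctions n M →ₗ[ℂ] Module.End ℂ (holomorphicSections n L m) :=
  have hs (f : smoothFunctions n M) (s : holomorphicSections n L m) :
      (fun x => f.1 x • s.1 x) ∈ smoothSections n L m :=
    smul_mem_smoothSections f (holomorphicSections_le_smoothSections m s.2)
  have hT := isOrthogonalProjection_toeplitzOperator (m := m) hΩ hmetric
  LinearMap.mk₂ ℂ (toeplitzOperator Ω)
    (fun f g s => by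
      refine (hT (f + g) s).unique hΩ hmetric (hs _ _) ?_
      have h := (hT f s).add hΩ hmetric (hs f s) (hs g s) (hT g s)
      convert h using 1
      ext x
      exact add_smul _ _ _)
    (fun c f s => by
      refine (hT (c • f) s).unique hΩ hmetric (hs _ _) ?_
      convert (hT f s).smul c using 1
      ext x
      exact mul_smul _ _ _)
    (fun f s t => by
      refine (hT f (s + t)).unique hΩ hmetric (hs _ _) ?_
      have h := (hT f s).add hΩ hmetric (hs f s) (hs f t) (hT f t)
      convert h using 1
      ext x
      exact smul_add _ _ _)
    (fun c f s => by
      refine (hT f (c • s)).unique hΩ hmetric (hs _ _) ?_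
      convert (hT f s).smul c using 1
      ext x
      exact smul_comm (f.1 x) c (s.1 x))

theorem sectionInner_toeplitzMap (hΩ : IsKahlerForm Ω) (hmetric : IsSmoothMetric n L)
    [Nonempty M] (f : smoothFunctions n M)
    (u s : holomorphicSections n L m) :
    sectionInner Ω u.1 (toeplitzMap hΩ hmetric f s).1 =
      ∫ x, f.1 x * powHermitian m x (u.1 x) (s.1 x) ∂(liouvilleMeasure Ω) := by
  have hs : ∀ u : holomorphicSections n L m, u.1 ∈ smoothSections n L m := fun u =>
    holomorphicSections_le_smoothSections m u.2
  have h := isOrthogonalProjection_toeplitzOperator hΩ hmetric f s u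
  rw [sectionInner_sub_right hΩ hmetric (hs u) (smul_mem_smoothSections f (hs s)) (hs _),
    sub_eq_zero] at h
  refine h.symm.trans ?_
  simp only [sectionInner, powHermitian_smul_right]

/-- If the matrices `(⟨bᵢ, T_f bⱼ⟩)` lay in a hyperplane with normal `a`, then `∑ aᵢⱼ h(bᵢ, bⱼ)` would
be orthogonal to all smooth functions, hence zero. -/
theorem toeplitzMap_surjective (hΩ : IsKahlerForm Ω) (hmetric : IsSmoothMetric n L)
    [ConnectedSpace M] :
    Function.Surjective (toeplitzMap (L := L) (m := m) hΩ hmetric) := by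
  have := finiteDimensional_holomorphicSections (m := m) hmetric
  let b := Module.finBasis ℂ (holomorphicSections n L m)
  let d := Module.finrank ℂ (holomorphicSections n L m)
  let Φ : Module.End ℂ (holomorphicSections n L m) →ₗ[ℂ] (Fin d × Fin d → ℂ) :=
    LinearMap.pi fun p => (LinearMap.proj p.1) ∘ₗ (gramMap hΩ hmetric b) ∘ₗ
      (LinearMap.applyₗ (b p.2))
  have hΦ : ∀ B p, Φ B p = sectionInner Ω (b p.1).1 (B (b p.2)).1 := fun B p => rfl
  have hΦinj : Function.Injective Φ := by
    intro B B' h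
    refine b.ext fun j => gramMap_injective hΩ hmetric b ?_
    ext i
    exact congrFun h (i, j)
  have hrange : LinearMap.range (Φ ∘ₗ toeplitzMap hΩ hmetric) = ⊤ := by
    by_contra hne
    obtain ⟨ℓ, hℓ, hle⟩ := Submodule.exists_le_ker_of_lt_top _ (lt_top_iff_ne_top.2 hne)
    apply hℓ
    let a : Fin d → Fin d → ℂ := fun i j => ℓ (Pi.single (i, j) 1)
    have hℓa : ∀ X : Fin d × Fin d → ℂ, ℓ X = ∑ i, ∑ j, a i j * X (i, j) := by
      intro X
      rw [LinearMap.pi_apply_eq_sum_univ ℓ X, Fintype.sum_prod_type]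
      simp only [a, smul_eq_mul, mul_comm]
      refine Finset.sum_congr rfl fun i _ => Finset.sum_congr rfl fun j _ => ?_
      congr 2
      ext q
      simp [Pi.single_apply, eq_comm]
    have hs : ∀ u : holomorphicSections n L m, u.1 ∈ smoothSections n L m := fun u =>
      holomorphicSections_le_smoothSections m u.2
    let K : M → ℂ := fun x => ∑ i, ∑ j, a i j * powHermitian m x ((b i).1 x) ((b j).1 x)
    have hK : K ∈ smoothFunctions n M := by
      have h : ∑ i, ∑ j, a i j • (fun x => powHermitian m x ((b i).1 x) ((b j).1 x)) ∈
          smoothFunctions n M :=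
        Subalgebra.sum_mem _ fun i _ => Subalgebra.sum_mem _ fun j _ => Subalgebra.smul_mem _
          (powHermitian_mem_smoothFunctions hmetric (hs (b i)) (hs (b j))) _
      convert h using 1
      ext x
      simp [K, Finset.sum_apply]
    -- Testing against `f = conj K` gives `∫ |K|² = 0`.
    let f : smoothFunctions n M := ⟨fun x => conj (K x), conj_mem_smoothFunctions hK⟩
    have hf : Continuous f.1 := smoothFunctions.continuous f.2
    have h0 : ℓ (Φ (toeplitzMap hΩ hmetric f)) = 0 := hle ⟨f, rfl⟩
    have hint : ∀ i j, Integrable (fun x => a i j *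
        (f.1 x * powHermitian m x ((b i).1 x) ((b j).1 x))) (liouvilleMeasure Ω) := fun i j =>
      integrable_of_continuous hΩ (continuous_const.mul (hf.mul (smoothFunctions.continuous
        (powHermitian_mem_smoothFunctions hmetric (hs (b i)) (hs (b j))))))
    have h1 : ∫ x, conj (K x) * K x ∂(liouvilleMeasure Ω) = 0 := by
      rw [← h0, hℓa]
      simp only [hΦ, sectionInner_toeplitzMap, ← integral_const_mul]
      have hsum : ∀ i, ∑ j, ∫ x, a i j * (f.1 x * powHermitian m x ((b i).1 x) ((b j).1 x))
          ∂(liouvilleMeasure Ω) = ∫ x, ∑ j, a i j * (f.1 x *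
            powHermitian m x ((b i).1 x) ((b j).1 x)) ∂(liouvilleMeasure Ω) := fun i =>
        (integral_finsetSum _ fun j _ => hint i j).symm
      rw [Finset.sum_congr rfl fun i _ => hsum i,
        ← integral_finsetSum _ fun i _ => integrable_finsetSum _ fun j _ => hint i j]
      refine integral_congr_ae (Filter.Eventually.of_forall fun x => ?_)
      have hfK : ∀ k : ℂ, k * K x =
          ∑ i, ∑ j, a i j * (k * powHermitian m x ((b i).1 x) ((b j).1 x)) := fun k => by
        simp only [K, Finset.mul_sum, mul_left_comm]
      exact hfK (f.1 x)
    have hK0 : ∀ x, K x = 0 := by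
      intro x
      have := eq_zero_of_integral_eq_zero hΩ (f := fun x => conj (K x) * K x)
        (hf.mul (smoothFunctions.continuous hK))
        (fun x => by rw [Complex.conj_mul']; simp) h1 x
      simpa using this
    have ha := coeff_eq_zero_of_sum_powHermitian_eq_zero b.linearIndependent hK0
    refine LinearMap.ext fun X => ?_
    rw [hℓa, LinearMap.zero_apply]
    exact Finset.sum_eq_zero fun i _ => Finset.sum_eq_zero fun j _ => by rw [ha i j, zero_mul]
  intro B
  obtain ⟨f, hf⟩ := LinearMap.range_eq_top.1 hrange (Φ B)
  exact ⟨f, hΦinj hf⟩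

end Toeplitz

end

theorem mainTheorem5 {n : ℕ} {M : Type*} [TopologicalSpace M] [T2Space M] [CompactSpace M]
    [ConnectedSpace M] [ChartedSpace (Fin n → ℂ) M] [IsManifold 𝓘(ℂ, Fin n → ℂ) ω M]
    [MeasurableSpace M] [BorelSpace M]
    (Ω : Π x : M, TangentSpace 𝓘(ℝ, Fin n → ℂ) x [⋀^Fin 2]→L[ℝ] ℝ) (hΩ : IsKahlerForm Ω)
    {L : M → Type*} [∀ x, NormedAddCommGroup (L x)] [∀ x, InnerProductSpace ℂ (L x)]
    [TopologicalSpace (TotalSpace ℂ L)] [FiberBundle ℂ L] [VectorBundle ℂ ℂ L]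
    [ContMDiffVectorBundle ω ℂ L 𝓘(ℂ, Fin n → ℂ)]
    (D : CovariantDerivative 𝓘(ℝ, Fin n → ℂ) ℂ L) (hD : IsQuantumLineBundle Ω D) (m : ℕ) :
    (∀ ψ ∈ smoothSections n L m, ∃! t : holomorphicSections n L m, IsOrthogonalProjection Ω ψ t) ∧
    ∃ T : smoothFunctions n M →ₗ[ℂ] Module.End ℂ (holomorphicSections n L m),
      (∀ f s, T f s = toeplitzOperator Ω f s) ∧ Function.Surjective T := by
  have hmetric : IsSmoothMetric n L := hD.metric_smooth
  refine ⟨fun ψ hψ => ?_, toeplitzMap hΩ hmetric, fun f s => rfl, toeplitzMap_surjective hΩ hmetric⟩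
  obtain ⟨t, ht⟩ := exists_isOrthogonalProjection hΩ hmetric hψ
  exact ⟨t, ht, fun t' ht' => ht'.unique hΩ hmetric hψ ht⟩
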